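/- Let $G$ be a finite simple graph that is $3$-connected (it has more than three vertices, and deleting any set of fewer than three vertices leaves a connected graph) and claw-free (it has no induced subgraph isomorphic to $K_{1,3}$). Suppose that the number of vertices of $G$ is divisible by $3$, and let $e$ be an edge of $G$. A $\Lambda$-factor of $G$ is a subgraph of $G$ that contains all vertices of $G$ and each of whose connected components is a path on three vertices. Then (a1) $G$ has a $\Lambda$-factor that contains the edge $e$; and (a2) $G$ has a $\Lambda$-factor that does not contain the edge $e$; equivalently, the graph obtained from $G$ by deleting the edge $e$ has a $\Lambda$-factor. -/

import Mathlib

namespace LambdaFactor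

/-- `G` is `k`-connected: it has more than `k` vertices, and removing any set of fewer than `k`
vertices leaves a connected graph. -/
def IsKConnected {V : Type*} (k : ℕ) (G : SimpleGraph V) : Prop :=
  k < Nat.card V ∧ ∀ S : Finset V, S.card < k → (G.induce (S : Set V)ᶜ).Connected

/-- The claw `K_{1,3}`. -/
abbrev claw : SimpleGraph (Fin 1 ⊕ Fin 3) := completeBipartiteGraph (Fin 1) (Fin 3)

/-- `G` is claw-free: it contains no induced subgraph isomorphic to the claw. -/
def ClawFree {V : Type*} (G : SimpleGraph V) : Prop :=
  ¬ claw.IsIndContained G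

/-- The graph `Λ`: the path on three vertices. -/
abbrev Lam : SimpleGraph (Fin 3) := SimpleGraph.pathGraph 3

/-- The subgraph `P` of `G` is an `H`-packing of `G`: every component of `P` is isomorphic
to `H`. -/
def IsPacking {V W : Type*} {G : SimpleGraph V} (H : SimpleGraph W) (P : G.Subgraph) : Prop :=
  ∀ C : P.coe.ConnectedComponent, Nonempty (C.toSimpleGraph ≃g H)

/-- The subgraph `P` of `G` is an `H`-factor of `G`: an `H`-packing containing all vertices
of `G`. -/
def IsFactor {V W : Type*} {G : SimpleGraph V} (H : SimpleGraph W) (P : G.Subgraph) : Prop :=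
  IsPacking H P ∧ P.IsSpanning

end LambdaFactor

/-! The induction runs on a weaker kind of graph. Call a connected graph a chain if it has at most
two end-blocks; here this is expressed by fragments, nonempty parts attached at a single vertex, no
three of which are pairwise disjoint. The core is `Chain.hasFactor`: a claw-free chain of order
divisible by three has a Λ-factor. In the 3-connected graph every edge `xz` extends to a path `x z
w` whose deletion leaves a chain (`Conn3.exists_path`). Hence some factor has `x` as an end vertex
with sole neighbour `z`. Taking `xz = e` gives (a1), and another edge at an end of `e` gives (a2).

Claw-freeness acts in two ways: three pairwise nonadjacent pieces cannot all touch one vertex, so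
deletions create few end-blocks; and the neighbours of a cut vertex on one side form a clique, which
keeps the pieces connected and chain-like.

The chain theorem is proved by induction on the order. A 3-connected set loses a suitable path. At a
cut of two vertices, either side is a chain with none, one or both cut vertices added, and residues
modulo 3 choose the distribution (`Leg.factor`). At a cut vertex residues also suffice
(`Split.factor`), unless one side is a single leaf. The hard leaf case reduces to a set `H` without
cut vertices carrying two pendant paths `s - a` and `t - c` (`Tail.hasFactor`). Try a path `s a w`
with `w` in `H`. If the rest is not a chain, a claw argument at `w` provides a neighbour `e` of both
`a` and `w`, and the size modulo 3 of a maximal fragment around `e` decides whether `s a w` or `s a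
e` works. -/

namespace LambdaFactor

set_option linter.unusedSectionVars false

variable {V : Type*} [DecidableEq V] {G : SimpleGraph V}

/-! ### Connectivity through edge cuts, fragments and chains -/

/-- Among three distinct neighbours of a vertex, two are adjacent. -/
def NoClaw (G : SimpleGraph V) : Prop :=
  ∀ v a b c, G.Adj v a → G.Adj v b → G.Adj v c → a ≠ b → a ≠ c → b ≠ c →
    G.Adj a b ∨ G.Adj a c ∨ G.Adj b c

/-- The set `A` induces a connected subgraph, phrased in terms of edge cuts. -/
def Conn (G : SimpleGraph V) (A : Finset V) : Prop :=
  ∀ X ⊆ A, X.Nonempty → (∀ u ∈ X, ∀ v ∈ A, G.Adj u v → v ∈ X) → ∀ v ∈ A, v ∈ X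

/-- `A` is connected and has no cut vertex. -/
def Conn2 (G : SimpleGraph V) (A : Finset V) : Prop :=
  Conn G A ∧ ∀ X ⊆ A, X.Nonempty → ∀ p ∉ X,
    (∀ u ∈ X, ∀ v ∈ A, G.Adj u v → v ∈ X ∨ v = p) → ∀ v ∈ A, v ∈ X ∨ v = p

/-- `A` is connected and no two vertices separate it. -/
def Conn3 (G : SimpleGraph V) (A : Finset V) : Prop :=
  Conn2 G A ∧ ∀ X ⊆ A, X.Nonempty → ∀ p ∉ X, ∀ q ∉ X,
    (∀ u ∈ X, ∀ v ∈ A, G.Adj u v → v ∈ X ∨ v = p ∨ v = q) → ∀ v ∈ A, v ∈ X ∨ v = p ∨ v = q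

/-- `X` is a nonempty part of `A` attached to the rest of `A` only at the vertex `d`. -/
structure Frag (G : SimpleGraph V) (A X : Finset V) (d : V) : Prop where
  sub : X ⊆ A
  ne : X.Nonempty
  mem : d ∈ A
  nmem : d ∉ X
  closed : ∀ u ∈ X, ∀ v ∈ A, G.Adj u v → v ∈ X ∨ v = d

/-- `A` is connected with at most two end-blocks: no three fragments are pairwise disjoint. -/
def Chain (G : SimpleGraph V) (A : Finset V) : Prop :=
  Conn G A ∧ ∀ X Y Z x y z, Frag G A X x → Frag G A Y y → Frag G A Z z →
    Disjoint X Y → Disjoint X Z → Disjoint Y Z → False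

lemma Frag.touch {A X : Finset V} {d : V} (hA : Conn G A) (h : Frag G A X d) :
    ∃ u ∈ X, G.Adj u d := by
  by_contra! hc
  have := hA X h.sub h.ne (fun u hu v hv huv => by
    rcases h.closed u hu v hv huv with h1 | rfl
    · exact h1
    · exact absurd huv (hc u hu)) d h.mem
  exact h.nmem this

/-- Adjacent disjoint fragments contain each other's attachment vertices, so their union would be
closed in `A` and would have to contain `w`. -/
lemma Frag.not_adj {A X Y : Finset V} {x y w : V} (hA : Conn G A) (hX : Frag G A X x)
    (hY : Frag G A Y y) (hd : Disjoint X Y) (hw : w ∈ A) (hwX : w ∉ X) (hwY : w ∉ Y) :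
    ∀ u ∈ X, ∀ v ∈ Y, ¬ G.Adj u v := by
  intro u hu v hv huv
  have hd' := Finset.disjoint_left.1 hd
  have h1 : v = x := (hX.closed u hu v (hY.sub hv) huv).resolve_left (fun h => hd' h hv)
  have h2 : u = y := (hY.closed v hv u (hX.sub hu) huv.symm).resolve_left (fun h => hd' hu h)
  have := hA (X ∪ Y) (Finset.union_subset hX.sub hY.sub) ⟨u, by simp [hu]⟩
    (fun a ha b hb hab => by
      rcases Finset.mem_union.1 ha with ha | ha
      · rcases hX.closed a ha b hb hab with h | h
        · simp [h]
        · subst h; subst h1; simp [hv]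
      · rcases hY.closed a ha b hb hab with h | h
        · simp [h]
        · subst h; subst h2; simp [hu]) w hw
  grind

lemma Frag.not_adj₃ {A X Y Z : Finset V} {x y z : V} (hA : Conn G A) (hX : Frag G A X x)
    (hY : Frag G A Y y) (hZ : Frag G A Z z) (hXY : Disjoint X Y) (hXZ : Disjoint X Z)
    (hYZ : Disjoint Y Z) : ∀ u ∈ X, ∀ v ∈ Y, ¬ G.Adj u v := by
  obtain ⟨w, hw⟩ := hZ.ne
  exact hX.not_adj hA hY hXY (hZ.sub hw) (fun h => Finset.disjoint_left.1 hXZ h hw)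
    (fun h => Finset.disjoint_left.1 hYZ h hw)

/-- Three pairwise disjoint fragments of a connected set are pairwise nonadjacent. -/
lemma Frag.triple {A X Y Z : Finset V} {x y z : V} (hA : Conn G A) (hX : Frag G A X x)
    (hY : Frag G A Y y) (hZ : Frag G A Z z) (hXY : Disjoint X Y) (hXZ : Disjoint X Z)
    (hYZ : Disjoint Y Z) :
    (∀ u ∈ X, ∀ v ∈ Y, u ≠ v ∧ ¬ G.Adj u v) ∧ (∀ u ∈ X, ∀ v ∈ Z, u ≠ v ∧ ¬ G.Adj u v) ∧
      (∀ u ∈ Y, ∀ v ∈ Z, u ≠ v ∧ ¬ G.Adj u v) := by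
  refine ⟨fun u hu v hv => ⟨?_, Frag.not_adj₃ hA hX hY hZ hXY hXZ hYZ u hu v hv⟩,
    fun u hu v hv => ⟨?_, Frag.not_adj₃ hA hX hZ hY hXZ hXY hYZ.symm u hu v hv⟩,
    fun u hu v hv => ⟨?_, Frag.not_adj₃ hA hY hZ hX hYZ hXY.symm hXZ.symm u hu v hv⟩⟩
  · rintro rfl; exact Finset.disjoint_left.1 hXY hu hv
  · rintro rfl; exact Finset.disjoint_left.1 hXZ hu hv
  · rintro rfl; exact Finset.disjoint_left.1 hYZ hu hv

/-- Pigeonhole: two of three disjoint fragments would meet the same clique, although disjoint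
fragments in such a triple are nonadjacent. -/
lemma chain_of_cliques {S : Finset V} (P Q : V → Prop) (hS : Conn G S)
    (hP : ∀ u v, u ∈ S → v ∈ S → P u → P v → u ≠ v → G.Adj u v)
    (hQ : ∀ u v, u ∈ S → v ∈ S → Q u → Q v → u ≠ v → G.Adj u v)
    (h : ∀ X d, Frag G S X d → ∃ u ∈ X, P u ∨ Q u) : Chain G S := by
  refine ⟨hS, fun X Y Z x y z hX hY hZ h1 h2 h3 => ?_⟩
  obtain ⟨t1, t2, t3⟩ := Frag.triple hS hX hY hZ h1 h2 h3
  obtain ⟨a, ha, ha'⟩ := h X x hX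
  obtain ⟨b, hb, hb'⟩ := h Y y hY
  obtain ⟨c, hc, hc'⟩ := h Z z hZ
  have := t1 a ha b hb
  have := t2 a ha c hc
  have := t3 b hb c hc
  have := hX.sub ha
  have := hY.sub hb
  have := hZ.sub hc
  grind

/-- A connected part `S` of a chain, all of whose vertices with neighbours outside lie in a
clique, is a chain if a fragment is left outside. -/
lemma Chain.of_subset {A S Z : Finset V} {z : V} (P : V → Prop) (hA : Chain G A)
    (hSA : S ⊆ A) (hS : Conn G S) (hZ : Frag G A Z z) (hZS : ∀ u ∈ S, u ∈ Z → P u)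
    (hP : ∀ u v, u ∈ S → v ∈ S → P u → P v → u ≠ v → G.Adj u v)
    (hout : ∀ u ∈ S, ¬ P u → ∀ v ∈ A, G.Adj u v → v ∈ S) : Chain G S := by
  have key : ∀ X d, Frag G S X d → (∀ u ∈ X, ¬ P u) → Frag G A X d ∧ Disjoint X Z := by
    intro X d hX hXP
    refine ⟨⟨hX.sub.trans hSA, hX.ne, hSA hX.mem, hX.nmem, fun u hu v hv huv =>
      hX.closed u hu v (hout u (hX.sub hu) (hXP u hu) v hv huv) huv⟩, ?_⟩
    exact Finset.disjoint_left.2 fun u hu hu' => hXP u hu (hZS u (hX.sub hu) hu')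
  refine ⟨hS, fun X Y W x y w hX hY hW h1 h2 h3 => ?_⟩
  obtain ⟨t1, t2, t3⟩ := Frag.triple hS hX hY hW h1 h2 h3
  -- Nonadjacent fragments cannot both meet the clique `P`. So two of the three avoid it; these are
  -- fragments of `A`, and `Z` is a third.
  have two : ∀ X Y x y, Frag G S X x → Frag G S Y y →
      (∀ u ∈ X, ∀ v ∈ Y, u ≠ v ∧ ¬ G.Adj u v) → (∀ u ∈ X, ¬ P u) ∨ (∀ u ∈ Y, ¬ P u) := by
    intro X Y x y hX hY t
    by_contra! hc
    obtain ⟨⟨u, hu, hu'⟩, v, hv, hv'⟩ := hc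
    exact (t u hu v hv).2 (hP u v (hX.sub hu) (hY.sub hv) hu' hv' (t u hu v hv).1)
  have fin : ∀ X Y x y, Frag G S X x → Frag G S Y y → Disjoint X Y → (∀ u ∈ X, ¬ P u) →
      (∀ u ∈ Y, ¬ P u) → False := by
    intro X Y x y hX hY hd hXP hYP
    obtain ⟨a1, a2⟩ := key X x hX hXP
    obtain ⟨b1, b2⟩ := key Y y hY hYP
    exact hA.2 _ _ _ _ _ _ a1 b1 hZ hd a2 b2
  rcases two X Y x y hX hY t1 with a | a <;> rcases two X W x w hX hW t2 with b | b <;>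
    rcases two Y W y w hY hW t3 with c | c
  · exact fin X Y x y hX hY h1 a c
  · exact fin X W x w hX hW h2 a c
  · exact fin X Y x y hX hY h1 a c
  · exact fin X W x w hX hW h2 a b
  · exact fin X Y x y hX hY h1 b a
  · exact fin X W x w hX hW h2 b c
  · exact fin Y W y w hY hW h3 a b
  · exact fin Y W y w hY hW h3 a b

/-- Adding a vertex adjacent to a connected set keeps it connected. -/
lemma Conn.insert {A : Finset V} {a b : V} (hA : Conn G A) (hb : b ∈ A) (hab : G.Adj a b) :
    Conn G (insert a A) := by
  intro X hX hne hcl v hv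
  have hbX : b ∈ X := by
    by_cases h : ∃ u ∈ X, u ∈ A
    · obtain ⟨u, hu, huA⟩ := h
      have := hA (X ∩ A) Finset.inter_subset_right ⟨u, by simp [hu, huA]⟩
        (fun p hp q hq hpq => by
          simp only [Finset.mem_inter] at hp ⊢
          exact ⟨hcl p hp.1 q (by simp [hq]) hpq, hq⟩) b hb
      exact (Finset.mem_inter.1 this).1
    · push Not at h
      obtain ⟨u, hu⟩ := hne
      have h1 := hX hu
      have : u = a := (Finset.mem_insert.1 h1).resolve_right (h u hu)
      subst this
      exact hcl u hu b (by simp [hb]) hab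
  have hAX : ∀ v ∈ A, v ∈ X := by
    intro v hv
    have := hA (X ∩ A) Finset.inter_subset_right ⟨b, by simp [hbX, hb]⟩
        (fun p hp q hq hpq => by
          simp only [Finset.mem_inter] at hp ⊢
          exact ⟨hcl p hp.1 q (by simp [hq]) hpq, hq⟩) v hv
    exact (Finset.mem_inter.1 this).1
  rcases Finset.mem_insert.1 hv with rfl | h
  · exact hcl b hbX v (by simp) hab.symm
  · exact hAX v h

/-- The complement of a fragment is connected. -/
lemma Frag.conn_sdiff {A X : Finset V} {d : V} (hA : Conn G A) (hX : Frag G A X d) :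
    Conn G (A \ X) := by
  -- A closed part missing `d` would be closed in all of `A`. A set and its complement cannot both
  -- contain `d`.
  have key : ∀ Z ⊆ A \ X, Z.Nonempty → (∀ u ∈ Z, ∀ v ∈ A \ X, G.Adj u v → v ∈ Z) → d ∈ Z := by
    intro Z hZ hne hcl
    by_contra hd
    obtain ⟨u, hu⟩ := hX.ne
    have := hA Z (hZ.trans Finset.sdiff_subset) hne (fun a ha b hb hab => by
      by_cases hbX : b ∈ X
      · have haZ := Finset.mem_sdiff.1 (hZ ha)
        rcases hX.closed b hbX a haZ.1 hab.symm with h | h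
        · exact absurd h haZ.2
        · subst h; exact absurd ha hd
      · exact hcl a ha b (by simp [hb, hbX]) hab) u (hX.sub hu)
    exact (Finset.mem_sdiff.1 (hZ this)).2 hu
  intro Z hZ hne hcl v hv
  by_contra hvZ
  have h1 := key Z hZ hne hcl
  have h2 := key ((A \ X) \ Z) Finset.sdiff_subset ⟨v, by simp_all⟩ (fun a ha b hb hab => by
    simp only [Finset.mem_sdiff] at ha ⊢
    exact ⟨Finset.mem_sdiff.1 hb, fun hbZ => ha.2 (hcl b hbZ a (by simp [ha]) hab.symm)⟩)
  simp_all

/-- A fragment is minimal if it contains no smaller fragment. -/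
def MinFrag (G : SimpleGraph V) (A X : Finset V) (d : V) : Prop :=
  Frag G A X d ∧ ∀ Y y, Frag G A Y y → Y ⊆ X → X ⊆ Y

lemma Frag.exists_min {A X : Finset V} {d : V} (h : Frag G A X d) :
    ∃ Y y, MinFrag G A Y y ∧ Y ⊆ X := by
  induction X using Finset.strongInduction generalizing d with
  | H X ih =>
    by_cases hm : MinFrag G A X d
    · exact ⟨X, d, hm, subset_rfl⟩
    · have : ∃ Y y, Frag G A Y y ∧ Y ⊆ X ∧ ¬ X ⊆ Y := by
        by_contra! hc
        exact hm ⟨h, fun Y y h1 h2 => hc Y y h1 h2⟩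
      obtain ⟨Y, y, h1, h2, h3⟩ := this
      obtain ⟨Z, z, h4, h5⟩ := ih Y ⟨h2, h3⟩ h1
      exact ⟨Z, z, h4, h5.trans h2⟩

/-- A minimal fragment together with its attachment has no cut vertex other than the
attachment. -/
lemma MinFrag.conn_erase {A X : Finset V} {d w : V} (hX : MinFrag G A X d)
    (hw : w ∈ X) : Conn G ((insert d X).erase w) := by
  obtain ⟨hX, hmin⟩ := hX
  have key : ∀ Z ⊆ (insert d X).erase w, Z.Nonempty →
      (∀ u ∈ Z, ∀ v ∈ (insert d X).erase w, G.Adj u v → v ∈ Z) → d ∈ Z := by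
    intro Z hZ hne hcl
    by_contra hd
    have hZX : Z ⊆ X := fun u hu => by
      have := hZ hu
      grind
    have hwZ : w ∉ Z := fun h => by simpa using hZ h
    -- A closed part missing `d` would be a strictly smaller fragment, attached at `w`.
    have : Frag G A Z w := ⟨hZX.trans hX.sub, hne, hX.sub hw, hwZ, fun u hu v hv huv => by
      by_cases hvw : v = w
      · exact Or.inr hvw
      · left
        refine hcl u hu v ?_ huv
        have := hX.closed u (hZX hu) v hv huv
        grind⟩
    exact hwZ (hmin Z w this hZX hw)
  intro Z hZ hne hcl v hv
  by_contra hvZ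
  have h1 := key Z hZ hne hcl
  have h2 := key (((insert d X).erase w) \ Z) Finset.sdiff_subset
    ⟨v, Finset.mem_sdiff.2 ⟨hv, hvZ⟩⟩ (fun a ha b hb hab => by
      rw [Finset.mem_sdiff] at ha ⊢
      exact ⟨hb, fun hbZ => ha.2 (hcl b hbZ a ha.1 hab.symm)⟩)
  exact (Finset.mem_sdiff.1 h2).2 h1

/-- Two fragments, one of them minimal, that neither cover `A` nor contain each other are
disjoint. -/
lemma MinFrag.disjoint {A X U : Finset V} {d e w a b : V} (hA : Conn G A) (hX : MinFrag G A X d)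
    (hU : Frag G A U e) (hw : w ∈ A) (hwX : w ∉ X) (hwU : w ∉ U) (ha : a ∈ X) (haU : a ∉ U)
    (hb : b ∈ U) (hbX : b ∉ X) : Disjoint X U := by
  obtain ⟨hX, hmin⟩ := hX
  -- If `e ∈ X`, then `X ∪ U` or `U \ X` is closed in `A` and misses `w`. If `e ∉ X`, then `X \ U`
  -- is a fragment, and minimality of `X` makes it equal to `X`.
  by_cases heX : e ∈ X
  · exfalso
    by_cases hdU : d ∈ U
    · have := hA (X ∪ U) (Finset.union_subset hX.sub hU.sub) ⟨a, by simp [ha]⟩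
        (fun u hu v hv huv => by
          rcases Finset.mem_union.1 hu with h | h
          · have := hX.closed u h v hv huv
            grind
          · have := hU.closed u h v hv huv
            grind) w hw
      grind
    · have := hA (U \ X) (Finset.sdiff_subset.trans hU.sub) ⟨b, by simp [hb, hbX]⟩
        (fun u hu v hv huv => by
          rw [Finset.mem_sdiff] at hu ⊢
          have h1 := hU.closed u hu.1 v hv huv
          have h2 : v ∈ X → u ∈ X ∨ u = d := fun h => hX.closed v h u (hU.sub hu.1) huv.symm
          grind) w hw
      grind
  · have hF : Frag G A (X \ U) d := ⟨Finset.sdiff_subset.trans hX.sub, ⟨a, by simp [ha, haU]⟩,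
      hX.mem, fun h => hX.nmem (Finset.mem_sdiff.1 h).1, fun u hu v hv huv => by
        rw [Finset.mem_sdiff] at hu ⊢
        have h1 := hX.closed u hu.1 v hv huv
        have h2 : v ∈ U → u ∈ U ∨ u = e := fun h => hU.closed v h u (hX.sub hu.1) huv.symm
        grind⟩
    have := hmin _ _ hF Finset.sdiff_subset
    exact Finset.disjoint_left.2 fun u hu => (Finset.mem_sdiff.1 (this hu)).2

lemma Conn2.erase_conn {H : Finset V} {w : V} (hH : Conn2 G H) : Conn G (H.erase w) := by
  intro X hX hne hcl v hv
  have hwX : w ∉ X := fun h => by simpa using hX h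
  have := hH.2 X (hX.trans (Finset.erase_subset _ _)) hne w hwX (fun a ha b hb hab => by
    by_cases h : b = w
    · exact Or.inr h
    · exact Or.inl (hcl a ha b (by simp [h, hb]) hab)) v (Finset.mem_of_mem_erase hv)
  exact this.resolve_right (Finset.ne_of_mem_erase hv)

/-- A fragment of `H - w` with a vertex of `H` to spare is adjacent to `w`. -/
lemma Conn2.frag_touch {H X : Finset V} {d w : V} (hH : Conn2 G H) (hw : w ∈ H)
    (hX : X ⊆ H) (hne : X.Nonempty) (hwX : w ∉ X) (hdX : d ∉ X) (hwd : w ≠ d)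
    (hcl : ∀ u ∈ X, ∀ v ∈ H, G.Adj u v → v ∈ X ∨ v = d ∨ v = w) : ∃ u ∈ X, G.Adj w u := by
  by_contra! hc
  have := hH.2 X hX hne d hdX (fun u hu v hv huv => by
    rcases hcl u hu v hv huv with h | h | h
    · exact Or.inl h
    · exact Or.inr h
    · subst h; exact absurd huv.symm (hc u hu)) w hw
  grind

/-- Deleting a vertex from a claw-free set without cut vertices leaves a chain. -/
lemma Conn2.erase_chain {H : Finset V} {w : V} (hG : NoClaw G) (hH : Conn2 G H) (hw : w ∈ H) :
    Chain G (H.erase w) := by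
  have hc := hH.erase_conn (w := w)
  refine ⟨hc, fun X Y Z x y z hX hY hZ h1 h2 h3 => ?_⟩
  -- A fragment not seeing `w` would be cut off from `w` in `H` by its attachment. Three fragments
  -- seeing `w` give a claw.
  have key : ∀ X x, Frag G (H.erase w) X x → ∃ u ∈ X, G.Adj w u := by
    intro X x hX
    refine hH.frag_touch (d := x) hw (hX.sub.trans (Finset.erase_subset _ _)) hX.ne
      (fun h => by simpa using hX.sub h) hX.nmem (fun h => by simpa [h] using hX.mem)
      (fun u hu v hv huv => ?_)
    by_cases h : v = w
    · simp [h]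
    · have := hX.closed u hu v (by simp [h, hv]) huv
      tauto
  obtain ⟨t1, t2, t3⟩ := Frag.triple hc hX hY hZ h1 h2 h3
  obtain ⟨a, ha, ha'⟩ := key X x hX
  obtain ⟨b, hb, hb'⟩ := key Y y hY
  obtain ⟨c, hc, hc'⟩ := key Z z hZ
  have := t1 a ha b hb
  have := t2 a ha c hc
  have := t3 b hb c hc
  have := hG w a b c ha' hb' hc'
  tauto

/-! ### Partitions of a vertex set into three-vertex paths -/

/-- `A` can be partitioned into vertex sets of three-vertex paths of `G`. -/
inductive HasFactor (G : SimpleGraph V) : Finset V → Prop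
  | empty : HasFactor G ∅
  | cons {S : Finset V} {a b c : V} (ha : a ∉ S) (hb : b ∉ S) (hc : c ∉ S) (hab : G.Adj a b)
      (hbc : G.Adj b c) (hac : a ≠ c) (hS : HasFactor G S) :
      HasFactor G (insert a (insert b (insert c S)))

lemma HasFactor.add {S A : Finset V} {a b c : V} (hS : HasFactor G S) (hab : G.Adj a b)
    (hbc : G.Adj b c) (hac : a ≠ c) (ha : a ∉ S) (hb : b ∉ S) (hc : c ∉ S)
    (hA : ∀ v, v ∈ A ↔ v = a ∨ v = b ∨ v = c ∨ v ∈ S) : HasFactor G A := by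
  have : A = insert a (insert b (insert c S)) := by ext v; simp [hA]
  exact this ▸ .cons ha hb hc hab hbc hac hS

lemma HasFactor.union {A B C : Finset V} (hA : HasFactor G A) (hB : HasFactor G B)
    (hd : ∀ v ∈ A, v ∉ B) (hC : ∀ v, v ∈ C ↔ v ∈ A ∨ v ∈ B) : HasFactor G C := by
  induction hA generalizing C with
  | empty =>
    have : C = B := by ext v; simp [hC]
    exact this ▸ hB
  | @cons S a b c ha hb hc hab hbc hac hS ih =>
    refine (ih (C := S ∪ B) (fun v hv => hd v (by simp [hv])) (by simp)).add hab hbc hac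
      ?_ ?_ ?_ ?_
    · have := hd a (by simp); simp [ha, this]
    · have := hd b (by simp); simp [hb, this]
    · have := hd c (by simp); simp [hc, this]
    · intro v; simp [hC, or_assoc]

lemma HasFactor.exists_adj {A : Finset V} {x : V} (hA : HasFactor G A) (hx : x ∈ A) :
    ∃ v ∈ A, G.Adj x v := by
  induction hA with
  | empty => simp at hx
  | @cons S a b c _ _ _ hab hbc _ _ ih =>
    simp only [Finset.mem_insert] at hx
    rcases hx with rfl | rfl | rfl | hx
    · exact ⟨b, by simp, hab⟩
    · exact ⟨a, by simp, hab.symm⟩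
    · exact ⟨b, by simp, hbc.symm⟩
    · obtain ⟨v, hv, h⟩ := ih hx
      exact ⟨v, by simp [hv], h⟩

/-- A vertex with only the neighbour `c` is not the middle of its path, so that path is `x c w`; the
other paths form the remaining factor. -/
lemma HasFactor.pendant {A : Finset V} {x c : V} (hA : HasFactor G A) (hx : x ∈ A)
    (hxc : ∀ v ∈ A, G.Adj x v → v = c) :
    ∃ w ∈ A, w ≠ x ∧ w ≠ c ∧ G.Adj c w ∧ HasFactor G (A \ {x, c, w}) := by
  induction hA with
  | empty => simp at hx
  | @cons S a b d ha hb hd hab hbd had hS ih =>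
    by_cases hxS : x ∈ S
    · obtain ⟨w, hw, hwx, hwc, hcw, hF⟩ := ih hxS (fun v hv => hxc v (by simp [hv]))
      obtain ⟨v, hv, hxv⟩ := hS.exists_adj hxS
      have hcS : c ∈ S := hxc v (by simp [hv]) hxv ▸ hv
      refine ⟨w, by simp [hw], hwx, hwc, hcw, hF.add hab hbd had (by simp [ha]) (by simp [hb])
        (by simp [hd]) fun v => ?_⟩
      simp only [Finset.mem_sdiff, Finset.mem_insert, Finset.mem_singleton]
      by_cases hv : v ∈ S
      · have h1 : v ≠ a := fun e => ha (e ▸ hv)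
        have h2 : v ≠ b := fun e => hb (e ▸ hv)
        have h3 : v ≠ d := fun e => hd (e ▸ hv)
        simp only [hv, h1, h2, h3, false_or, or_true, true_and]
      · have h1 : v ≠ x := fun e => hv (e ▸ hxS)
        have h2 : v ≠ c := fun e => hv (e ▸ hcS)
        have h3 : v ≠ w := fun e => hv (e ▸ hw)
        simp [hv, h1, h2, h3]
    · have hab' := hab.ne
      have hbd' := hbd.ne
      simp only [Finset.mem_insert, hxS, or_false] at hx
      have hset : ∀ w, ({x, c, w} : Finset V) = {a, b, d} →
          insert a (insert b (insert d S)) \ {x, c, w} = S := by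
        intro w hw
        rw [hw]; ext v; simp; grind
      rcases hx with rfl | rfl | rfl
      · have : b = c := hxc b (by simp) hab
        subst this
        exact ⟨d, by simp, had.symm, hbd'.symm, hbd, by rwa [hset d rfl]⟩
      · have h1 : a = c := hxc a (by simp) hab.symm
        have h2 : d = c := hxc d (by simp) hbd
        exact absurd (h1.trans h2.symm) had
      · have : b = c := hxc b (by simp) hbd.symm
        subst this
        exact ⟨a, by simp, had, hab', hab.symm, by
          rwa [hset a (by ext v; simp; tauto)]⟩

/-! ### Chains with a cut vertex -/

/-- `A` is cut by the vertex `c` into the two parts `X` and `Y`. -/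
structure Split (G : SimpleGraph V) (A X Y : Finset V) (c : V) : Prop where
  left : Frag G A X c
  right : Frag G A Y c
  disj : ∀ v ∈ X, v ∉ Y
  cover : ∀ v ∈ A, v ∈ X ∨ v ∈ Y ∨ v = c

lemma Split.symm {A X Y : Finset V} {c : V} (h : Split G A X Y c) : Split G A Y X c :=
  ⟨h.right, h.left, fun v hv hv' => h.disj v hv' hv, fun v hv => by have := h.cover v hv; tauto⟩

lemma Split.of_frag {A X : Finset V} {c o : V} (hX : Frag G A X c) (ho : o ∈ A) (hoX : o ∉ X)
    (hoc : o ≠ c) : Split G A X ((A \ X).erase c) c := by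
  refine ⟨hX, ⟨by grind, ⟨o, by simp [*]⟩, hX.mem, by simp, fun u hu v hv huv => ?_⟩,
    by grind, by grind⟩
  have : v ∈ X → u ∈ X ∨ u = c := fun h => hX.closed v h u (by grind) huv.symm
  grind

lemma Conn.exists_split {A : Finset V} (hA : Conn G A) (h : ¬ Conn2 G A) :
    ∃ X Y c, Split G A X Y c := by
  have : ∃ X ⊆ A, X.Nonempty ∧ ∃ p ∉ X, (∀ u ∈ X, ∀ v ∈ A, G.Adj u v → v ∈ X ∨ v = p) ∧
      ∃ v ∈ A, ¬ (v ∈ X ∨ v = p) := by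
    by_contra! hc
    refine h ⟨hA, fun X hX hne p hp hcl v hv => ?_⟩
    have := hc X hX hne p hp hcl v hv
    tauto
  obtain ⟨X, hX, hne, p, hp, hcl, v, hv, hvX⟩ := this
  push Not at hvX
  have hpA : p ∈ A := by
    by_contra hpA
    refine hvX.1 (hA X hX hne (fun u hu v hv huv => ?_) v hv)
    rcases hcl u hu v hv huv with h | rfl
    · exact h
    · exact absurd hv hpA
  exact ⟨_, _, _, Split.of_frag ⟨hX, hne, hpA, hp, hcl⟩ hv hvX.1 hvX.2⟩

/-- A neighbour of `c` in `Y` is adjacent to nothing in `X`, so it is the third leaf of a claw at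
`c` unless the two given neighbours are adjacent. -/
lemma Split.clique {A X Y : Finset V} {c : V} (hG : NoClaw G) (hA : Conn G A)
    (h : Split G A X Y c) : ∀ u ∈ X, ∀ v ∈ X, G.Adj c u → G.Adj c v → u ≠ v → G.Adj u v := by
  obtain ⟨y, hy, hyc⟩ := h.right.touch hA
  have key : ∀ u ∈ X, u ≠ y ∧ ¬ G.Adj u y := by
    intro u hu
    refine ⟨fun e => h.disj u hu (e ▸ hy), fun e => ?_⟩
    rcases h.left.closed u hu y (h.right.sub hy) e with e | e
    · exact h.disj y e hy
    · exact h.right.nmem (e ▸ hy)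
  intro u hu v hv hcu hcv huv
  have := hG c u v y hcu hcv hyc.symm huv (key u hu).1 (key v hv).1
  have := key u hu
  have := key v hv
  tauto

/-- If `X` fell into two parts, these and `Y` would be three disjoint fragments attached at `c`. -/
lemma Split.conn_left {A X Y : Finset V} {c : V} (hA : Chain G A) (h : Split G A X Y c) :
    Conn G X := by
  intro Z hZ hne hcl v hv
  by_contra hvZ
  refine hA.2 Z (X \ Z) Y c c c
    ⟨hZ.trans h.left.sub, hne, h.left.mem, fun e => h.left.nmem (hZ e), fun u hu w hw huw => ?_⟩
    ⟨Finset.sdiff_subset.trans h.left.sub, ⟨v, by simp [*]⟩, h.left.mem,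
      fun e => h.left.nmem (Finset.mem_sdiff.1 e).1, fun u hu w hw huw => ?_⟩
    h.right Finset.disjoint_sdiff ?_ ?_
  · have := h.left.closed u (hZ hu) w hw huw
    have := hcl u hu w
    tauto
  · rw [Finset.mem_sdiff] at hu ⊢
    have := h.left.closed u hu.1 w hw huw
    have := fun e => hcl w e u hu.1 huw.symm
    tauto
  · exact Finset.disjoint_left.2 fun u hu => h.disj u (hZ hu)
  · exact Finset.disjoint_left.2 fun u hu => h.disj u (Finset.mem_sdiff.1 hu).1

lemma Split.chain_left {A X Y : Finset V} {c : V} (hG : NoClaw G) (hA : Chain G A)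
    (h : Split G A X Y c) : Chain G X := by
  refine hA.of_subset (G.Adj c) h.left.sub (h.conn_left hA) h.right
    (fun u hu hu' => absurd hu' (h.disj u hu))
    (fun u v hu hv hcu hcv huv => h.clique hG hA.1 u hu v hv hcu hcv huv) ?_
  intro u hu hcu v hv huv
  refine (h.left.closed u hu v hv huv).resolve_right ?_
  rintro rfl
  exact hcu huv.symm

lemma Split.chain_insert {A X Y : Finset V} {c : V} (hA : Chain G A)
    (h : Split G A X Y c) : Chain G (insert c X) := by
  obtain ⟨x, hx, hxc⟩ := h.left.touch hA.1
  refine hA.of_subset (· = c) (Finset.insert_subset h.left.mem h.left.sub)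
    ((h.conn_left hA).insert hx hxc.symm) h.right ?_ (by grind) ?_
  · intro u hu hu'
    have := h.disj u
    grind
  · intro u hu huc v hv huv
    have := h.left.closed u (by grind) v hv huv
    grind

/-- The vertex `y` serves as a pendant at `c` standing in for `Y`; it later forces the path through
`c`. -/
lemma Split.chain_insert_insert {A X Y : Finset V} {c y : V} (hA : Chain G A)
    (h : Split G A X Y c) (hy : y ∈ Y) (hcy : G.Adj c y) :
    Chain G (insert y (insert c X)) := by
  obtain ⟨x, hx, hxc⟩ := h.left.touch hA.1
  refine hA.of_subset (fun u => u = c ∨ u = y) ?_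
    (((h.conn_left hA).insert hx hxc.symm).insert (b := c) (by simp) hcy.symm) h.right ?_ ?_ ?_
  · exact Finset.insert_subset (h.right.sub hy) (Finset.insert_subset h.left.mem h.left.sub)
  · intro u hu hu'
    have := h.disj u
    grind
  · have := hcy.symm
    grind
  · intro u hu huc v hv huv
    have := h.left.closed u (by grind) v hv huv
    grind

/-- All smaller chains of size divisible by three have a factor. -/
def FactorBelow (G : SimpleGraph V) (n : ℕ) : Prop :=
  ∀ B : Finset V, B.card < n → Chain G B → B.card % 3 = 0 → HasFactor G B

lemma Split.card {A X Y : Finset V} {c : V} (h : Split G A X Y c) :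
    A.card = X.card + Y.card + 1 := by
  have h1 : A = insert c (X ∪ Y) := by
    ext v
    have := h.cover v
    have := @h.left.sub v
    have := @h.right.sub v
    have := h.left.mem
    grind
  have hl := h.left.nmem
  have hr := h.right.nmem
  rw [h1, Finset.card_insert_of_notMem (by grind), Finset.card_union_of_disjoint
    (Finset.disjoint_left.2 h.disj)]

lemma Split.pos_left {A X Y : Finset V} {c : V} (h : Split G A X Y c) : 0 < X.card :=
  h.left.ne.card_pos

lemma Split.factor_of_left {A X Y : Finset V} {c : V} (hG : NoClaw G) (hA : Chain G A)
    (ih : FactorBelow G A.card) (h : Split G A X Y c) (h3 : A.card % 3 = 0)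
    (hX : X.card % 3 = 0) : HasFactor G A := by
  have hc := h.card
  have hp := h.pos_left
  have hp' := h.symm.pos_left
  have hY : (insert c Y).card = Y.card + 1 := Finset.card_insert_of_notMem h.right.nmem
  have h1 := ih X (by omega) (h.chain_left hG hA) hX
  have h2 := ih (insert c Y) (by omega) (h.symm.chain_insert hA) (by omega)
  refine h1.union h2 ?_ ?_
  · intro v hv
    have := h.disj v hv
    have := h.left.nmem
    grind
  · intro v
    have := h.cover v
    have := @h.left.sub v
    have := @h.right.sub v
    have := h.left.mem
    grind

/-- The part of a chain beyond a cut vertex `c` loses a neighbour of `c` and has a factor. -/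
lemma Split.exists_factor_erase {A X Y : Finset V} {c : V} (hA : Chain G A)
    (ih : FactorBelow G A.card) (h : Split G A X Y c) (hX : X.card % 3 = 1)
    (hY : 1 < Y.card) : ∃ w ∈ X, G.Adj c w ∧ HasFactor G (X.erase w) := by
  obtain ⟨y, hy, hyc⟩ := h.right.touch hA.1
  have hyX : y ∉ X := fun e => h.disj y e hy
  have hyc' : y ≠ c := hyc.ne
  have hcX := h.left.nmem
  have h1 : (insert y (insert c X)).card = X.card + 2 := by
    rw [Finset.card_insert_of_notMem (by grind), Finset.card_insert_of_notMem hcX]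
  -- The test set `X + c + y` has order divisible by three and is smaller than `A` because `Y` has
  -- more than one vertex. Its factor must cover the pendant `y` by a path `y c w`.
  have hF := ih _ (by have := h.card; omega) (h.chain_insert_insert hA hy hyc.symm) (by omega)
  obtain ⟨w, hw, hwy, hwc, hcw, hF⟩ := hF.pendant (x := y) (c := c) (by simp) (by
    intro v hv hyv
    have : v ∈ X → y ∈ X ∨ y = c := fun e => h.left.closed v e y (h.right.sub hy) hyv.symm
    have := hyv.ne
    grind)
  refine ⟨w, by grind, hcw, ?_⟩
  convert hF using 1
  ext v
  grind

/-- If neither side has size divisible by three, both are 1 modulo 3. Each side then loses one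
neighbour of `c`, and these two neighbours form a path through `c`. This fails only when a side is a
single vertex. -/
lemma Split.factor {A X Y : Finset V} {c : V} (hG : NoClaw G) (hA : Chain G A)
    (ih : FactorBelow G A.card) (h : Split G A X Y c) (h3 : A.card % 3 = 0) :
    HasFactor G A ∨ X.card = 1 ∨ Y.card = 1 := by
  have hc := h.card
  have hp := h.pos_left
  have hp' := h.symm.pos_left
  by_cases hX : X.card % 3 = 0
  · exact Or.inl (h.factor_of_left hG hA ih h3 hX)
  by_cases hY : Y.card % 3 = 0
  · exact Or.inl (h.symm.factor_of_left hG hA ih h3 hY)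
  by_cases hX1 : X.card = 1
  · exact Or.inr (Or.inl hX1)
  by_cases hY1 : Y.card = 1
  · exact Or.inr (Or.inr hY1)
  left
  obtain ⟨w, hw, hcw, hF⟩ := h.exists_factor_erase hA ih (by omega) (by omega)
  obtain ⟨z, hz, hcz, hF'⟩ := h.symm.exists_factor_erase hA ih (by omega) (by omega)
  have hd := h.disj
  have hl := h.left.nmem
  have hr := h.right.nmem
  refine (hF.union hF' (C := (X.erase w) ∪ (Y.erase z)) (by grind) (by grind)).add hcw.symm hcz
    (by grind) (by grind) (by grind) (by grind) (fun v => ?_)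
  have := h.cover v
  have := @h.left.sub v
  have := @h.right.sub v
  have := h.left.mem
  grind

/-! ### Cuts of two vertices in sets without cut vertices -/

/-- `X` is cut off from `H` by the two vertices `p` and `q`. -/
structure Leg (G : SimpleGraph V) (H X : Finset V) (p q : V) : Prop where
  sub : X ⊆ H
  ne : X.Nonempty
  memp : p ∈ H
  memq : q ∈ H
  pq : p ≠ q
  pX : p ∉ X
  qX : q ∉ X
  closed : ∀ u ∈ X, ∀ v ∈ H, G.Adj u v → v ∈ X ∨ v = p ∨ v = q
  other : ∃ o ∈ H, o ∉ X ∧ o ≠ p ∧ o ≠ q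

lemma Leg.swap {H X : Finset V} {p q : V} (h : Leg G H X p q) : Leg G H X q p := by
  obtain ⟨a, b, c, d, e, f, g, i, o, h1, h2, h3, h4⟩ := h
  exact ⟨a, b, d, c, e.symm, g, f, fun u hu v hv huv => by have := i u hu v hv huv; tauto,
    o, h1, h2, h4, h3⟩

lemma Leg.compl {H X : Finset V} {p q : V} (h : Leg G H X p q) :
    Leg G H (((H \ X).erase p).erase q) p q := by
  obtain ⟨o, ho, h1, h2, h3⟩ := h.other
  obtain ⟨x, hx⟩ := h.ne
  refine ⟨by grind, ⟨o, by simp [*]⟩, h.memp, h.memq, h.pq, by simp, by simp, ?_,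
    x, h.sub hx, by grind, fun e => h.pX (e ▸ hx), fun e => h.qX (e ▸ hx)⟩
  intro u hu v hv huv
  have : v ∈ X → u ∈ X ∨ u = p ∨ u = q := fun e => h.closed v e u (by grind) huv.symm
  grind

lemma Leg.touch {H X : Finset V} {p q : V} (hH : Conn2 G H) (h : Leg G H X p q) :
    ∃ u ∈ X, G.Adj p u :=
  hH.frag_touch h.memp h.sub h.ne h.pX h.qX h.pq (fun u hu v hv huv => by
    have := h.closed u hu v hv huv
    tauto)

lemma Leg.clique {H X : Finset V} {p q : V} (hG : NoClaw G) (hH : Conn2 G H)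
    (h : Leg G H X p q) : ∀ u v, u ∈ X → v ∈ X → G.Adj p u → G.Adj p v → u ≠ v → G.Adj u v := by
  obtain ⟨y, hy, hpy⟩ := h.compl.touch hH
  have key : ∀ u ∈ X, u ≠ y ∧ ¬ G.Adj u y := by
    intro u hu
    have : G.Adj u y → y ∈ X ∨ y = p ∨ y = q := h.closed u hu y (by grind)
    grind
  intro u v hu hv hpu hpv huv
  have := hG p u v y hpu hpv hpy huv (key u hu).1 (key v hv).1
  have := key u hu
  have := key v hv
  tauto

/-- Each closed part of `X` sees `p`, as otherwise `q` alone would separate it, and the neighbours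
of `p` in `X` form a clique. -/
lemma Leg.conn {H X : Finset V} {p q : V} (hG : NoClaw G) (hH : Conn2 G H)
    (h : Leg G H X p q) : Conn G X := by
  intro Z hZ hne hcl v hv
  by_contra hvZ
  have hT : ∀ Z ⊆ X, Z.Nonempty → (∀ u ∈ Z, ∀ v ∈ X, G.Adj u v → v ∈ Z) →
      ∃ u ∈ Z, G.Adj p u := by
    intro Z hZ hne hcl
    refine hH.frag_touch h.memp (hZ.trans h.sub) hne (fun e => h.pX (hZ e))
      (fun e => h.qX (hZ e)) h.pq (fun u hu v hv huv => ?_)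
    have := h.closed u (hZ hu) v hv huv
    have := hcl u hu v
    tauto
  obtain ⟨a, ha, hpa⟩ := hT Z hZ hne hcl
  obtain ⟨b, hb, hpb⟩ := hT (X \ Z) Finset.sdiff_subset ⟨v, by simp [*]⟩ (fun u hu w hw huw => by
    have := fun e => hcl w e u (by grind) huw.symm
    grind)
  have hab : a ≠ b := by grind
  have := h.clique hG hH a b (hZ ha) (by grind) hpa hpb hab
  have := hcl a ha b (by grind) this
  grind

/-- In a set without cut vertices, a fragment of a part of a leg that avoids the boundary
of the leg cannot exist. -/
lemma Leg.frag_false {H X S Z : Finset V} {p q d : V} (hH : Conn2 G H) (h : Leg G H X p q)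
    (hZ : Frag G S Z d) (hZX : Z ⊆ X) (hXS : X ⊆ S) (hSX : ∀ v ∈ S, v ∈ X ∨ v = p ∨ v = q)
    (hp : p ∉ S → ∀ u ∈ Z, ¬ G.Adj p u) (hq : q ∉ S → ∀ u ∈ Z, ¬ G.Adj q u) : False := by
  obtain ⟨o, ho, h1, h2, h3⟩ := h.other
  have := hH.2 Z (hZX.trans h.sub) hZ.ne d hZ.nmem (fun u hu v hv huv => by
    have h4 := h.closed u (hZX hu) v hv huv
    have h5 := hZ.closed u hu v
    have h6 := fun e => hp e u hu
    have h7 := fun e => hq e u hu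
    have := huv.symm
    grind) o ho
  have := hSX d hZ.mem
  grind

/-- Every fragment of `X` meets one of the two cliques of neighbours of `p` and of `q`: otherwise
its attachment would be a cut vertex of `H`. When `p` or `q` is added to `X`, the singleton of that
vertex replaces its clique. -/
lemma Leg.chain {H X : Finset V} {p q : V} (hG : NoClaw G) (hH : Conn2 G H)
    (h : Leg G H X p q) : Chain G X := by
  refine chain_of_cliques (G.Adj p) (G.Adj q) (h.conn hG hH) (h.clique hG hH)
    (h.swap.clique hG hH) ?_
  intro Z d hZ
  by_contra! hc
  exact h.frag_false hH hZ hZ.sub subset_rfl (by tauto) (fun _ u hu => (hc u hu).1)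
    (fun _ u hu => (hc u hu).2)

lemma Leg.chain_insert {H X : Finset V} {p q : V} (hG : NoClaw G) (hH : Conn2 G H)
    (h : Leg G H X p q) : Chain G (insert p X) := by
  obtain ⟨x, hx, hpx⟩ := h.touch hH
  have hq : q ∉ insert p X := by have := h.qX; have := h.pq; grind
  refine chain_of_cliques (· = p) (fun u => u ∈ X ∧ G.Adj q u) ((h.conn hG hH).insert hx hpx)
    (by grind) (fun u v _ _ hu hv => h.swap.clique hG hH u v hu.1 hv.1 hu.2 hv.2) ?_
  intro Z d hZ
  by_contra! hc
  have hZX : Z ⊆ X := fun u hu => by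
    have := hZ.sub hu
    have := (hc u hu).1
    grind
  exact h.frag_false hH hZ hZX (by grind) (by grind) (by grind)
    (fun _ u hu => (hc u hu).2 (hZX hu))

lemma Leg.chain_insert_insert {H X : Finset V} {p q : V} (hG : NoClaw G) (hH : Conn2 G H)
    (h : Leg G H X p q) : Chain G (insert q (insert p X)) := by
  obtain ⟨x, hx, hpx⟩ := h.touch hH
  obtain ⟨y, hy, hqy⟩ := h.swap.touch hH
  refine chain_of_cliques (· = p) (· = q) (((h.conn hG hH).insert hx hpx).insert
    (Finset.mem_insert_of_mem hy) hqy) (by grind) (by grind) ?_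
  intro Z d hZ
  by_contra! hc
  have hZX : Z ⊆ X := fun u hu => by
    have := hZ.sub hu
    have := hc u hu
    grind
  exact h.frag_false hH hZ hZX (by grind) (by grind) (by grind) (by grind)

lemma Leg.card {H X : Finset V} {p q : V} (h : Leg G H X p q) :
    H.card = X.card + (((H \ X).erase p).erase q).card + 2 := by
  have hp := h.pX
  have hq := h.qX
  have hpq := h.pq
  have hpH := h.memp
  have hqH := h.memq
  have h1 := Finset.card_erase_add_one (s := (H \ X).erase p) (a := q) (by grind)
  have h2 := Finset.card_erase_add_one (s := H \ X) (a := p) (by grind)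
  have h3 := Finset.card_sdiff_add_card_eq_card h.sub
  omega

/-- The sizes of the two sides sum to 1 modulo 3. According to the residue of `X`, both cut vertices
join `Y`, both join `X`, or each side receives one. -/
lemma Leg.factor {H X : Finset V} {p q : V} (hG : NoClaw G) (hH : Conn2 G H)
    (ih : FactorBelow G H.card) (h3 : H.card % 3 = 0) (h : Leg G H X p q) : HasFactor G H := by
  have h' := h.compl
  have hc := h.card
  set Y := ((H \ X).erase p).erase q with hY
  have hX0 := h.ne.card_pos
  have hY0 := h'.ne.card_pos
  have c1 : ∀ Z, Leg G H Z p q → (insert p Z).card = Z.card + 1 :=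
    fun Z hZ => Finset.card_insert_of_notMem hZ.pX
  have c1' : ∀ Z, Leg G H Z p q → (insert q Z).card = Z.card + 1 :=
    fun Z hZ => Finset.card_insert_of_notMem hZ.qX
  have c2 : ∀ Z, Leg G H Z p q → (insert q (insert p Z)).card = Z.card + 2 := fun Z hZ => by
    rw [Finset.card_insert_of_notMem, c1 Z hZ]
    have := hZ.qX; have := hZ.pq; grind
  have hp := h.pX
  have hq := h.qX
  have hpq := h.pq
  have hpH := h.memp
  have hqH := h.memq
  have hsub := h.sub
  by_cases hx0 : X.card % 3 = 0
  · refine (ih X (by omega) (h.chain hG hH) hx0).union (ih (insert q (insert p Y))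
      (by rw [c2 Y h']; omega) (h'.chain_insert_insert hG hH) (by rw [c2 Y h']; omega)) ?_ ?_ <;>
    grind
  by_cases hx1 : X.card % 3 = 1
  · refine (ih Y (by omega) (h'.chain hG hH) (by omega)).union (ih (insert q (insert p X))
      (by rw [c2 X h]; omega) (h.chain_insert_insert hG hH) (by rw [c2 X h]; omega)) ?_ ?_ <;>
    grind
  · refine (ih (insert p X) (by rw [c1 X h]; omega) (h.chain_insert hG hH)
      (by rw [c1 X h]; omega)).union (ih (insert q Y)
      (by rw [c1' Y h']; omega) (h'.swap.chain_insert hG hH) (by rw [c1' Y h']; omega)) ?_ ?_ <;>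
    grind

/-- A failure of `Conn3` allows `p = q` or vertices outside `A`; these degenerate cuts reduce to a
single cut vertex and are excluded by `key`. -/
lemma Conn2.exists_leg {A : Finset V} (hA : Conn2 G A) (h : ¬ Conn3 G A) :
    ∃ X p q, Leg G A X p q := by
  have : ∃ X ⊆ A, X.Nonempty ∧ ∃ p ∉ X, ∃ q ∉ X,
      (∀ u ∈ X, ∀ v ∈ A, G.Adj u v → v ∈ X ∨ v = p ∨ v = q) ∧
      ∃ v ∈ A, ¬ (v ∈ X ∨ v = p ∨ v = q) := by
    by_contra! hc
    refine h ⟨hA, fun X hX hne p hp q hq hcl v hv => ?_⟩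
    have := hc X hX hne p hp q hq hcl v hv
    tauto
  obtain ⟨X, hX, hne, p, hp, q, hq, hcl, v, hv, hvX⟩ := this
  push Not at hvX
  have key : ∀ r ∉ X, ¬ ∀ u ∈ X, ∀ v ∈ A, G.Adj u v → v ∈ X ∨ v = r := by
    intro r hr hcl'
    have := hA.2 X hX hne r hr hcl'
    have hvr := (this v hv).resolve_left hvX.1
    have h1 := hA.1 X hX hne (fun u hu w hw huw => by
      have := hcl u hu w hw huw
      have := hcl' u hu w hw huw
      grind) v hv
    exact hvX.1 h1
  refine ⟨X, p, q, hX, hne, ?_, ?_, ?_, hp, hq, hcl, v, hv, hvX⟩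
  · by_contra hpA
    exact key q hq fun u hu v hv huv => by have := hcl u hu v hv huv; grind
  · by_contra hqA
    exact key p hp fun u hu v hv huv => by have := hcl u hu v hv huv; grind
  · rintro rfl
    exact key p hp fun u hu v hv huv => by have := hcl u hu v hv huv; grind

/-! ### Deleting an edge and a further vertex from a 3-connected set -/

/-- No vertex of `X` equals or is adjacent to a vertex of `Y`. -/
def Apart (G : SimpleGraph V) (X Y : Finset V) : Prop :=
  ∀ u ∈ X, ∀ v ∈ Y, u ≠ v ∧ ¬ G.Adj u v

lemma Apart.symm {X Y : Finset V} (h : Apart G X Y) : Apart G Y X :=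
  fun u hu v hv => ⟨(h v hv u hu).1.symm, fun e => (h v hv u hu).2 e.symm⟩

lemma Apart.disjoint {X Y : Finset V} (h : Apart G X Y) : Disjoint X Y :=
  Finset.disjoint_left.2 fun u hu hv => (h u hu u hv).1 rfl

/-- Three disjoint fragments distributed over three classes either repeat a class or represent each
class once. A class may be `False` when two suffice. -/
lemma chain_of_classes {S : Finset V} (P Q R : Finset V → Prop) (hS : Conn G S)
    (h : ∀ X x, Frag G S X x → P X ∨ Q X ∨ R X)
    (hP : ∀ X Y x y, Frag G S X x → Frag G S Y y → Apart G X Y → P X → P Y → False)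
    (hQ : ∀ X Y x y, Frag G S X x → Frag G S Y y → Apart G X Y → Q X → Q Y → False)
    (hR : ∀ X Y x y, Frag G S X x → Frag G S Y y → Apart G X Y → R X → R Y → False)
    (hPQR : ∀ X Y Z x y z, Frag G S X x → Frag G S Y y → Frag G S Z z → Apart G X Y →
      Apart G X Z → Apart G Y Z → P X → Q Y → R Z → False) : Chain G S := by
  refine ⟨hS, fun X Y Z x y z hX hY hZ h1 h2 h3 => ?_⟩
  obtain ⟨t1, t2, t3⟩ := Frag.triple hS hX hY hZ h1 h2 h3
  change Apart G X Y at t1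
  change Apart G X Z at t2
  change Apart G Y Z at t3
  rcases h X x hX with a | a | a <;> rcases h Y y hY with b | b | b <;>
    first
    | exact hP _ _ _ _ hX hY t1 a b
    | exact hQ _ _ _ _ hX hY t1 a b
    | exact hR _ _ _ _ hX hY t1 a b
    | (rcases h Z z hZ with c | c | c <;>
        first
        | exact hP _ _ _ _ hX hZ t2 a c
        | exact hQ _ _ _ _ hX hZ t2 a c
        | exact hR _ _ _ _ hX hZ t2 a c
        | exact hP _ _ _ _ hY hZ t3 b c
        | exact hQ _ _ _ _ hY hZ t3 b c
        | exact hR _ _ _ _ hY hZ t3 b c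
        | exact hPQR _ _ _ _ _ _ hX hY hZ t1 t2 t3 a b c
        | exact hPQR _ _ _ _ _ _ hX hZ hY t2 t1 t3.symm a c b
        | exact hPQR _ _ _ _ _ _ hY hX hZ t1.symm t3 t2 b a c
        | exact hPQR _ _ _ _ _ _ hY hZ hX t3 t1.symm t2.symm b c a
        | exact hPQR _ _ _ _ _ _ hZ hX hY t2.symm t3.symm t1 c a b
        | exact hPQR _ _ _ _ _ _ hZ hY hX t3.symm t2.symm t1.symm c b a)

/-- A part of a connected set `A` that is closed in `A` and meets `A` contains `A`. -/
lemma Conn.subset_of_closed {A Z : Finset V} {a : V} (hA : Conn G A) (ha : a ∈ A) (haZ : a ∈ Z)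
    (hcl : ∀ u ∈ A, u ∈ Z → ∀ v ∈ A, G.Adj u v → v ∈ Z) : A ⊆ Z := by
  intro v hv
  have := hA (A ∩ Z) Finset.inter_subset_left ⟨a, by simp [*]⟩ (fun u hu w hw huw => by
    rw [Finset.mem_inter] at hu ⊢
    exact ⟨hw, hcl u hu.1 hu.2 w hw huw⟩) v hv
  exact (Finset.mem_inter.1 this).2

lemma Conn.union {A B C : Finset V} {d : V} (hA : Conn G A) (hB : Conn G B) (hdA : d ∈ A)
    (hdB : d ∈ B) (hC : ∀ v, v ∈ C ↔ v ∈ A ∨ v ∈ B) : Conn G C := by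
  intro Z hZ hne hcl v hv
  have hd : d ∈ Z := by
    obtain ⟨u, hu⟩ := hne
    rcases (hC u).1 (hZ hu) with h | h
    · exact hA.subset_of_closed h hu (fun a _ ha' b hb hab => hcl a ha' b ((hC b).2 (.inl hb)) hab)
        hdA
    · exact hB.subset_of_closed h hu (fun a _ ha' b hb hab => hcl a ha' b ((hC b).2 (.inr hb)) hab)
        hdB
  rcases (hC v).1 hv with h | h
  · exact hA.subset_of_closed hdA hd (fun a _ ha' b hb hab => hcl a ha' b ((hC b).2 (.inl hb)) hab)
      h
  · exact hB.subset_of_closed hdB hd (fun a _ ha' b hb hab => hcl a ha' b ((hC b).2 (.inr hb)) hab)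
      h

lemma Conn3.conn_erase_erase {A : Finset V} {x y : V} (hA : Conn3 G A) :
    Conn G ((A.erase x).erase y) := by
  intro Z hZ hne hcl v hv
  have := hA.2 Z (fun u hu => by have := hZ hu; grind) hne x (fun h => by have := hZ h; grind) y
    (fun h => by have := hZ h; grind) (fun a ha b hb hab => by
      have := hcl a ha b
      grind) v (by grind)
  grind

lemma Conn3.frag_touch {A X : Finset V} {x y d : V} (hA : Conn3 G A) (hx : x ∈ A) (hxy : x ≠ y)
    (hX : Frag G ((A.erase x).erase y) X d) : ∃ u ∈ X, G.Adj x u := by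
  by_contra! hc
  have hd := hX.mem
  have hxX : x ∉ X := fun h => by have := hX.sub h; grind
  have := hA.2 X (fun u hu => by have := hX.sub hu; grind) hX.ne d hX.nmem y
    (fun h => by have := hX.sub h; grind) (fun u hu v hv huv => by
      have := hX.closed u hu v
      have := hc u hu
      have := huv.symm
      grind) x hx
  grind

/-- By 3-connectivity every fragment left sees `x`, so three disjoint ones would give a claw at `x`.
-/
lemma Conn3.chain_erase_erase {A : Finset V} {x y : V} (hG : NoClaw G) (hA : Conn3 G A)
    (hx : x ∈ A) (hxy : x ≠ y) : Chain G ((A.erase x).erase y) := by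
  refine ⟨hA.conn_erase_erase, fun X Y Z d e f hX hY hZ h1 h2 h3 => ?_⟩
  obtain ⟨t1, t2, t3⟩ := Frag.triple hA.conn_erase_erase hX hY hZ h1 h2 h3
  obtain ⟨a, ha, ha'⟩ := hA.frag_touch hx hxy hX
  obtain ⟨b, hb, hb'⟩ := hA.frag_touch hx hxy hY
  obtain ⟨c, hc, hc'⟩ := hA.frag_touch hx hxy hZ
  have := t1 a ha b hb
  have := t2 a ha c hc
  have := t3 b hb c hc
  have := hG x a b c ha' hb' hc'
  tauto

/-- The vertex `w` is a neighbour of `x` in the minimal fragment `X`. Fragments of what remains are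
sorted by lying inside `X`, containing the attachment `d`, or neither. -/
lemma Conn3.exists_erase_of_minFrag {A X Y : Finset V} {x y d e : V} (hG : NoClaw G)
    (hA : Conn3 G A) (hx : x ∈ A) (hy : y ∈ A) (hxy : x ≠ y)
    (hX : MinFrag G ((A.erase x).erase y) X d) (hY : Frag G ((A.erase x).erase y) Y e)
    (hXY : Apart G X Y) (hsub : ∀ u ∈ X, G.Adj x u → G.Adj y u) :
    ∃ w ∈ (A.erase x).erase y, G.Adj x w ∧ G.Adj y w ∧
      Chain G (((A.erase x).erase y).erase w) := by
  have hchain := hA.chain_erase_erase hG hx hxy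
  obtain ⟨w, hw, hxw⟩ := hA.frag_touch hx hxy hX.1
  obtain ⟨b, hb, hyb⟩ := hA.frag_touch (x := y) (y := x) hy hxy.symm
    (X := Y) (d := e) (by rwa [Finset.erase_right_comm])
  have hclique : ∀ u ∈ X, ∀ v ∈ X, G.Adj y u → G.Adj y v → u ≠ v → G.Adj u v := by
    intro u hu v hv h1 h2 h3
    have := hXY u hu b hb
    have := hXY v hv b hb
    have := hG y u v b h1 h2 hyb
    tauto
  have hxA : x ∉ (A.erase x).erase y := by simp
  have hyA : y ∉ (A.erase x).erase y := by simp
  have hmem : ∀ v ∈ A, v ≠ x → v ≠ y → v ∈ (A.erase x).erase y := by grind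
  have hsubA : (A.erase x).erase y ⊆ A := by grind
  set H := (A.erase x).erase y with hH
  have hdX := hX.1.nmem
  have hdH := hX.1.mem
  have hXH := hX.1.sub
  have hW := hX.conn_erase hw
  have hR := hX.1.conn_sdiff hchain.1
  have hdw : d ≠ w := fun h => hdX (h ▸ hw)
  refine ⟨w, hXH hw, hxw, hsub w hw hxw, chain_of_classes (· ⊆ X) (d ∈ ·)
    (fun Z => ¬ Z ⊆ X ∧ d ∉ Z) (hW.union (d := d) hR (by simp [hdw]) (Finset.mem_sdiff.2 ⟨hdH, hdX⟩)
      (fun v => by grind)) (fun Z _ _ => by tauto) ?_ ?_ ?_ ?_⟩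
  · have touch : ∀ Z z, Frag G (H.erase w) Z z → Z ⊆ X → ∃ u ∈ Z, G.Adj y u := by
      intro Z z hZ hZX
      by_contra! hc
      have hz := hZ.mem
      have hwZ : w ∉ Z := fun h => by have := hZ.sub h; grind
      have := hA.2 Z (fun u hu => hsubA (hXH (hZX hu))) hZ.ne z hZ.nmem w hwZ
        (fun u hu v hv huv => by
          have h1 := hZ.closed u hu v
          have h2 := hc u hu
          have h3 := hsub u (hZX hu)
          have h4 := huv.symm
          have h5 := hmem v hv
          grind) x hx
      have : x ∈ H := by
        rcases this with h | h | h
        · exact hXH (hZX h)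
        · rw [h]; exact Finset.mem_of_mem_erase hz
        · rw [h]; exact hXH hw
      exact hxA this
    intro Y Z y' z hY hZ hYZ h1 h2
    obtain ⟨u, hu, hyu⟩ := touch Y y' hY h1
    obtain ⟨v, hv, hyv⟩ := touch Z z hZ h2
    exact (hYZ u hu v hv).2 (hclique u (h1 hu) v (h2 hv) hyu hyv (hYZ u hu v hv).1)
  · intro Y Z _ _ _ _ hYZ h1 h2
    exact (hYZ d h1 d h2).1 rfl
  · have key : ∀ Z z, Frag G (H.erase w) Z z → ¬ Z ⊆ X ∧ d ∉ Z → Frag G H (Z \ X) z := by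
      intro Z z hZ hZX
      obtain ⟨o, ho, hoX⟩ := Finset.not_subset.1 hZX.1
      have hZs := hZ.sub
      refine ⟨fun u hu => by have := hZs (Finset.mem_sdiff.1 hu).1; grind, ⟨o, by simp [*]⟩,
        Finset.mem_of_mem_erase hZ.mem, fun h => hZ.nmem (Finset.mem_sdiff.1 h).1,
        fun u hu v hv huv => ?_⟩
      rw [Finset.mem_sdiff] at hu ⊢
      have h1 := hZ.closed u hu.1 v
      have h2 : v ∈ X → u ∈ X ∨ u = d := fun h => hX.1.closed v h u
        (Finset.mem_of_mem_erase (hZs hu.1)) huv.symm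
      grind
    intro Y Z y' z hY hZ hYZ h1 h2
    refine hchain.2 _ _ _ _ _ _ hX.1 (key Y y' hY h1) (key Z z hZ h2) Finset.disjoint_sdiff
      Finset.disjoint_sdiff ?_
    exact hYZ.disjoint.mono Finset.sdiff_subset Finset.sdiff_subset
  · intro Z₁ Z₂ Z₃ z₁ z₂ z₃ h₁ h₂ h₃ h12 h13 h23 c₁ c₂ c₃
    -- The fragment containing `d` swallows `H \ X` if its attachment lies in `X`, and `X + d - w`
    -- otherwise; either leaves no room for one of the other fragments.
    by_cases hz : z₂ ∈ X
    · have : H \ X ⊆ Z₂ := hR.subset_of_closed (Finset.mem_sdiff.2 ⟨hdH, hdX⟩) c₂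
        (fun u hu hu' v hv huv => by
          have := h₂.closed u hu' v
          grind)
      obtain ⟨o, ho, hoX⟩ := Finset.not_subset.1 c₃.1
      have h1 := h₃.sub ho
      exact (h23 o (this (by grind)) o ho).1 rfl
    · have hz2 := h₂.nmem
      have : (insert d X).erase w ⊆ Z₂ := hW.subset_of_closed (a := d) (by simp [*]) c₂
        (fun u hu hu' v hv huv => by
          have := h₂.closed u hu' v
          grind)
      obtain ⟨o, ho⟩ := h₁.ne
      have h1 := h₁.sub ho
      have h2 := c₁ ho
      exact (h12 o ho o (this (by grind))).1 rfl

/-- In a 3-connected claw-free set, deleting an edge `xy` and a further vertex leaves a chain,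
either for every further vertex, or for some common neighbour of `x` and `y`. -/
lemma Conn3.exists_chain {A : Finset V} {x y : V} (hG : NoClaw G) (hA : Conn3 G A) (hx : x ∈ A)
    (hy : y ∈ A) (hxy : G.Adj x y) :
    (∀ w ∈ (A.erase x).erase y, Chain G (((A.erase x).erase y).erase w)) ∨
    ∃ w ∈ (A.erase x).erase y, G.Adj x w ∧ G.Adj y w ∧
      Chain G (((A.erase x).erase y).erase w) := by
  by_cases h2 : Conn2 G ((A.erase x).erase y)
  · exact Or.inl fun w hw => h2.erase_chain hG hw
  right
  have hconn := hA.conn_erase_erase (x := x) (y := y)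
  obtain ⟨P, Q, c, hs⟩ := hconn.exists_split h2
  obtain ⟨X, d, hX, hXP⟩ := hs.left.exists_min
  obtain ⟨Y, e, hY, hYQ⟩ := hs.right.exists_min
  have hXY : Apart G X Y := by
    intro u hu v hv
    have h1 := hs.disj u (hXP hu)
    have h2 := hs.left.closed u (hXP hu) v (hs.right.sub (hYQ hv))
    have h3 := hs.right.nmem
    have h4 := hYQ hv
    have h5 := hs.disj v
    refine ⟨fun e => h1 (e ▸ h4), fun e => ?_⟩
    rcases h2 e with h | h
    · exact h5 h h4
    · exact h3 (h ▸ h4)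
  have hne := hxy.ne
  by_cases hc : ∀ u ∈ X, G.Adj x u → G.Adj y u
  · exact hA.exists_erase_of_minFrag hG hx hy hne hX hY.1 hXY hc
  · push Not at hc
    obtain ⟨a, ha, hxa, hya⟩ := hc
    -- With `a` a neighbour of `x` but not of `y`, the leaves `a`, `b`, `y` at `x` force `b` to be
    -- adjacent to `y`.
    refine hA.exists_erase_of_minFrag hG hx hy hne hY hX.1 hXY.symm fun b hb hxb => ?_
    have h1 := hXY a ha b hb
    have hay : a ≠ y := fun h => by have := hX.1.sub ha; grind
    have hby : b ≠ y := fun h => by have := hY.1.sub hb; grind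
    have := hG x a b y hxa hxb hxy h1.1 hay hby
    have h2 : ¬ G.Adj a y := fun h => hya h.symm
    have : G.Adj b y := by tauto
    exact this.symm

/-! ### A set without cut vertices with a pendant path -/

/-- A path `c - t` attached to `H` at `c`, which has at least two neighbours in `H`. -/
structure Tail (G : SimpleGraph V) (H : Finset V) (c t : V) : Prop where
  conn2 : Conn2 G H
  cH : c ∉ H
  tH : t ∉ H
  adj : G.Adj c t
  leaf : ∀ v ∈ H, ¬ G.Adj t v
  two : ∃ k ∈ H, ∃ l ∈ H, k ≠ l ∧ G.Adj c k ∧ G.Adj c l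

/-- The set `H - w` together with the tail `c - t`. -/
abbrev tailSet (H : Finset V) (c t w : V) : Finset V := insert t (insert c (H.erase w))

lemma Tail.conn {H : Finset V} {c t w : V} (h : Tail G H c t) : Conn G (tailSet H c t w) := by
  obtain ⟨k, hk, l, hl, hkl, hck, hcl⟩ := h.two
  have : ∃ a ∈ H.erase w, G.Adj c a := by
    by_cases hkw : k = w
    · exact ⟨l, by grind, hcl⟩
    · exact ⟨k, by grind, hck⟩
  obtain ⟨a, ha, hca⟩ := this
  exact (h.conn2.erase_conn.insert ha hca).insert (b := c) (by simp) h.adj.symm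

lemma Tail.card {H : Finset V} {c t w : V} (h : Tail G H c t) (hw : w ∈ H) :
    (tailSet H c t w).card = H.card + 1 := by
  have h1 := h.cH
  have h2 := h.tH
  have h3 := h.adj.ne
  have := Finset.card_erase_add_one hw
  rw [Finset.card_insert_of_notMem (by grind), Finset.card_insert_of_notMem (by grind)]
  omega

/-- Properties of a fragment of `H - w` with tail that avoids the tail, provided that some other
vertex of `H - w` is not in it. -/
structure Tail.Avoid (G : SimpleGraph V) (H : Finset V) (c w : V) (Z : Finset V) (z : V) :
    Prop where
  sub : Z ⊆ H
  ne : Z.Nonempty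
  nmem : z ∉ Z
  wZ : w ∉ Z
  zH : z ∈ H
  zw : z ≠ w
  closed : ∀ u ∈ Z, ∀ v ∈ H, G.Adj u v → v ∈ Z ∨ v = z ∨ v = w
  nadj : ∀ u ∈ Z, ¬ G.Adj c u
  touch : ∃ u ∈ Z, G.Adj w u

lemma Tail.avoid {H Z : Finset V} {c t w z o : V} (h : Tail G H c t) (hw : w ∈ H)
    (hZ : Frag G (tailSet H c t w) Z z) (hc : c ∉ Z) (ht : t ∉ Z) (ho : o ∈ H) (hoZ : o ∉ Z)
    (how : o ≠ w) : Tail.Avoid G H c w Z z := by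
  have hZH : Z ⊆ H.erase w := fun u hu => by have := hZ.sub hu; grind
  have hcH := h.cH
  have hwZ : w ∉ Z := fun e => by have := hZH e; grind
  have hcl : ∀ u ∈ Z, ∀ v ∈ H, G.Adj u v → v ∈ Z ∨ v = z ∨ v = w := fun u hu v hv huv => by
    have := hZ.closed u hu v
    grind
  have hzt : z ≠ t := by
    rintro rfl
    obtain ⟨u, hu, hut⟩ := hZ.touch h.conn
    exact h.leaf u (by grind) hut.symm
  have hzc : z ≠ c := by
    intro hzc
    have := h.conn2.erase_conn (w := w) Z hZH hZ.ne (fun u hu v hv huv => by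
      have := hcl u hu v
      grind) o (by grind)
    exact hoZ this
  have hz : z ∈ H ∧ z ≠ w := by have := hZ.mem; grind
  refine ⟨fun u hu => by have := hZH hu; grind, hZ.ne, hZ.nmem, hwZ, hz.1, hz.2, hcl, ?_, ?_⟩
  · intro u hu hcu
    have := hZ.closed u hu c (by simp) hcu.symm
    grind
  · exact h.conn2.frag_touch (d := z) hw (fun u hu => by have := hZH hu; grind) hZ.ne hwZ hZ.nmem
      hz.2.symm hcl

/-- Since `c` and `t` are adjacent, at most one of three fragments in a bad triple meets the tail;
the other two avoid it. -/
lemma Tail.exists_pair {H : Finset V} {c t w : V} (h : Tail G H c t)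
    (hw : w ∈ H) (hS : ¬ Chain G (tailSet H c t w)) :
    ∃ X x Y y, Frag G (tailSet H c t w) X x ∧ Frag G (tailSet H c t w) Y y ∧ Apart G X Y ∧
      c ∉ X ∧ t ∉ X ∧ c ∉ Y ∧ t ∉ Y ∧ Tail.Avoid G H c w X x ∧ Tail.Avoid G H c w Y y := by
  by_contra! hc
  have key : ∀ X x Y y, Frag G (tailSet H c t w) X x → Frag G (tailSet H c t w) Y y →
      Apart G X Y → c ∉ X ∧ t ∉ X → c ∉ Y ∧ t ∉ Y → False := by
    intro X x Y y hX hY hXY h1 h2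
    obtain ⟨a, ha⟩ := hX.ne
    obtain ⟨b, hb⟩ := hY.ne
    have haH : a ∈ H ∧ a ≠ w := by have := hX.sub ha; grind
    have hbH : b ∈ H ∧ b ≠ w := by have := hY.sub hb; grind
    exact hc X x Y y hX hY hXY h1.1 h1.2 h2.1 h2.2
      (h.avoid hw hX h1.1 h1.2 hbH.1 (fun e => (hXY b e b hb).1 rfl) hbH.2)
      (h.avoid hw hY h2.1 h2.2 haH.1 (fun e => (hXY a ha a e).1 rfl) haH.2)
  refine hS ((chain_of_classes (fun X => c ∉ X ∧ t ∉ X) (fun X => ¬ (c ∉ X ∧ t ∉ X))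
    (fun _ => False) h.conn (fun _ _ _ => by tauto) ?_ ?_ (by tauto) (by tauto)))
  · exact fun X Y x y hX hY hXY h1 h2 => key X x Y y hX hY hXY h1 h2
  · intro X Y x y hX hY hXY h1 h2
    have hct := h.adj
    have h3 := hct.symm
    have := hXY c
    have := hXY t
    grind

/-- If two fragments apart from each other avoid the tail, then `c` is not adjacent to `w`. -/
lemma Tail.Avoid.not_adj {H X Y : Finset V} {c w x y : V} (hG : NoClaw G)
    (hX : Tail.Avoid G H c w X x) (hY : Tail.Avoid G H c w Y y) (hXY : Apart G X Y)
    (hcH : c ∉ H) : ¬ G.Adj c w := by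
  intro hcw
  obtain ⟨a, ha, hwa⟩ := hX.touch
  obtain ⟨b, hb, hwb⟩ := hY.touch
  have h1 := hXY a ha b hb
  have hca : c ≠ a := fun e => hcH (e ▸ hX.sub ha)
  have hcb : c ≠ b := fun e => hcH (e ▸ hY.sub hb)
  have := hG w c a b hcw.symm hwa hwb hca hcb h1.1
  have := hX.nadj a ha
  have := hY.nadj b hb
  tauto

/-- Moving the deleted vertex from `w` to a neighbour `e` in a minimal fragment gives a chain. -/
lemma Tail.chain_of_minFrag {H X : Finset V} {c t w g e f b : V} (hG : NoClaw G)
    (h : Tail G H c t) (hw : w ∈ H) (hX : MinFrag G (tailSet H c t w) X g)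
    (hav : Tail.Avoid G H c w X g) (hcw : ¬ G.Adj c w) (he : e ∈ X)
    (hwe : G.Adj w e) (hf : f ∈ X ∨ f = g) (hfe : f ≠ e) (hwf : G.Adj w f) (hb : b ∈ H)
    (hbX : b ∉ X) (hbg : b ≠ g) (hwb : G.Adj w b) : Chain G (tailSet H c t e) := by
  by_contra hS
  obtain ⟨Z₁, z₁, Z₂, z₂, -, -, hZZ, -, -, -, -, h₁, h₂⟩ := h.exists_pair (hav.sub he) hS
  have hW := hX.conn_erase he
  have hR : Conn G ((H.erase w) \ X) := by
    refine Frag.conn_sdiff h.conn2.erase_conn (d := g) ⟨fun u hu => ?_, hav.ne, ?_, hav.nmem,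
      fun u hu v hv huv => ?_⟩
    · have := hav.sub hu
      have := hav.wZ
      grind
    · have := hav.zH
      have := hav.zw
      grind
    · have := hav.closed u hu v
      grind
  have hge : g ≠ e := fun h => hav.nmem (h ▸ he)
  have hgX := hav.nmem
  have hgH := hav.zH
  have hgw := hav.zw
  have hwX := hav.wZ
  have hXH := hav.sub
  have hbw : b ≠ w := hwb.ne.symm
  have hbe : b ≠ e := fun h => hbX (h ▸ he)
  have hgR : g ∈ (H.erase w) \ X := by grind
  have hbR : b ∈ (H.erase w) \ X := by grind
  obtain ⟨k, hk, l, hl, hkl, hck, hcl⟩ := h.two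
  have hR' : ∀ k ∈ H, G.Adj c k → k ∈ (H.erase w) \ X := by
    intro k hk hck
    have : k ≠ w := fun e => hcw (e ▸ hck)
    have : k ∉ X := fun e => hav.nadj k e hck
    grind
  have hkR := hR' k hk hck
  have hlR := hR' l hl hcl
  -- Neither `k` nor `l` lies in a fragment avoiding the tail. The vertex `f` ties `w` to the
  -- connected set `X + g - e`, and `b` ties `w` to the connected set `H - w - X`. This first forces
  -- `z` into `X + g` and then keeps `w` out of `Z`.
  have claim : ∀ Z z, Tail.Avoid G H c e Z z → w ∉ Z ∧ w ≠ z := by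
    intro Z z hZ
    have hkZ : k ∉ Z := fun h => hZ.nadj k h hck
    have hlZ : l ∉ Z := fun h => hZ.nadj l h hcl
    have hzZ := hZ.nmem
    have heZ := hZ.wZ
    have hze := hZ.zw
    have hzH := hZ.zH
    have hZH := hZ.sub
    have hRZ : z ∉ (H.erase w) \ X → ∀ a ∈ (H.erase w) \ X, a ∈ Z → False := by
      intro hz a ha haZ
      have := hR.subset_of_closed ha haZ (fun u hu hu' v hv huv => by
        have := hZ.closed u hu' v
        grind)
      exact hkZ (this hkR)
    have hzW : z ∈ X ∨ z = g := by
      by_contra! hz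
      have hWZ : ∀ a ∈ (insert g X).erase e, a ∈ Z → (insert g X).erase e ⊆ Z := by
        intro a ha haZ
        exact hW.subset_of_closed ha haZ (fun u hu hu' v hv huv => by
          have := hZ.closed u hu' v
          grind)
      obtain ⟨u, hu, heu⟩ := hZ.touch
      have hu' := hav.closed e he u (hZH hu) heu
      have hfW : f ∈ (insert g X).erase e := by grind
      have hfZ : f ∈ Z := by
        by_cases huw : u = w
        · subst huw
          have := hZ.closed u hu f (by grind) hwf
          grind
        · exact hWZ u (by grind) hu hfW
      have hsub := hWZ f hfW hfZ
      have hgZ : g ∈ Z := hsub (by grind)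
      by_cases hzw : z = w
      · exact hRZ (by grind) g hgR hgZ
      · have hwZ : w ∈ Z := by
          have := hZ.closed f hfZ w hw hwf.symm
          grind
        have hne : ∃ o ∈ H, o ∉ Z ∧ o ≠ z ∧ o ≠ e := by
          by_cases hkz : k = z
          · exact ⟨l, by grind⟩
          · exact ⟨k, by grind⟩
        obtain ⟨o, ho, ho1, ho2, ho3⟩ := hne
        have := h.conn2.2 (((H \ Z).erase z).erase e) (by grind) ⟨o, by grind⟩ z (by simp)
          (fun u hu v hv huv => by
            have h1 := hZ.closed v
            have h2 := hav.closed e he u (by grind)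
            have h3 := huv.symm
            have h4 : u ∈ X → u ∈ Z := fun h => hsub (by grind)
            grind) e (hXH he)
        grind
    have hwzz : w ≠ z := by grind
    refine ⟨fun hwZ => ?_, hwzz⟩
    have hbZ : b ∈ Z := by
      have := hZ.closed w hwZ b hb hwb
      grind
    by_cases hzg : z = g
    · have hne : ∃ o ∈ H, o ∉ Z ∧ o ≠ g ∧ o ∉ X ∧ o ≠ w := by
        by_cases hkz : k = g
        · exact ⟨l, by grind⟩
        · exact ⟨k, by grind⟩
      obtain ⟨o, ho, ho1, ho2, ho3, ho4⟩ := hne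
      have := h.conn2.2 (((H \ X) \ Z).erase g) (by grind) ⟨o, by grind⟩ g (by simp)
          (fun u hu v hv huv => by
            have h1 := hZ.closed v
            have h2 := hav.closed v
            have h3 := huv.symm
            grind) e (hXH he)
      grind
    · exact hRZ (by grind) b hbR hbZ
  -- The vertices `w`, `a₁`, `a₂` are leaves at `e`; an edge from `w` to `aᵢ` would make `w` a
  -- member or the attachment of `Zᵢ`, against `claim`.
  obtain ⟨a₁, ha₁, hea₁⟩ := h₁.touch
  obtain ⟨a₂, ha₂, hea₂⟩ := h₂.touch
  have c₁ := claim _ _ h₁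
  have c₂ := claim _ _ h₂
  have d₁ := h₁.closed a₁ ha₁ w hw
  have d₂ := h₂.closed a₂ ha₂ w hw
  have d₃ := hZZ a₁ ha₁ a₂ ha₂
  have d₄ := hwe.ne
  rcases hG e w a₁ a₂ hwe.symm hea₁ hea₂ (fun h => c₁.1 (h ▸ ha₁)) (fun h => c₂.1 (h ▸ ha₂))
    d₃.1 with h | h | h
  · rcases d₁ h.symm with h | h | h
    exacts [c₁.1 h, c₁.2 h, d₄ h]
  · rcases d₂ h.symm with h | h | h
    exacts [c₂.1 h, c₂.2 h, d₄ h]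
  · exact d₃.2 h

lemma Frag.exists_max {A X : Finset V} {d : V} (P : Finset V → Prop) (hX : Frag G A X d)
    (hP : P X) :
    ∃ Y y, Frag G A Y y ∧ P Y ∧ ∀ Z z, Frag G A Z z → P Z → Z.card ≤ Y.card := by
  induction hn : A.card - X.card using Nat.strong_induction_on generalizing X d with
  | _ n ih =>
    by_cases hm : ∀ Z z, Frag G A Z z → P Z → Z.card ≤ X.card
    · exact ⟨X, d, hX, hP, hm⟩
    · push Not at hm
      obtain ⟨Z, z, hZ, hPZ, hlt⟩ := hm
      have := Finset.card_le_card hZ.sub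
      exact ih _ (by omega) hZ hPZ rfl

/-! ### Maximal fragments and the choice between two deleted vertices -/

/-- The data of a set `H` with tail `c - t` and deleted vertex `w` such that the remaining set
splits off a maximal fragment `X`, starting from a neighbour `e` of `w`, while another
neighbour `b` of `w` cannot be swallowed by such a fragment. -/
structure Tail.Max (G : SimpleGraph V) (H : Finset V) (c t w e b : V) (X : Finset V) (g : V) :
    Prop where
  tail : Tail G H c t
  hw : w ∈ H
  frag : Frag G (tailSet H c t w) X g
  cX : c ∉ X
  tX : t ∉ X
  eX : e ∈ X
  we : G.Adj w e
  bH : b ∈ H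
  bX : b ∉ X
  bg : b ≠ g
  wb : G.Adj w b
  cw : ¬ G.Adj c w
  max : ∀ U u, Frag G (tailSet H c t w) U u → X ⊆ U → b ∉ U → c ∉ U → t ∉ U → U.card ≤ X.card

section

variable {H X : Finset V} {c t w e b g : V}

lemma Tail.Max.avoid (h : Tail.Max G H c t w e b X g) : Tail.Avoid G H c w X g :=
  h.tail.avoid h.hw h.frag h.cX h.tX h.bH h.bX h.wb.ne.symm

/-- Restoring `w` makes it the second cut vertex. Of the two neighbours of `c`, neither in `X` nor
equal to `w`, one differs from `g` and lies on the other side. -/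
lemma Tail.Max.leg (h : Tail.Max G H c t w e b X g) : Leg G H X g w := by
  have hav := h.avoid
  obtain ⟨k, hk, l, hl, hkl, hck, hcl⟩ := h.tail.two
  refine ⟨hav.sub, hav.ne, hav.zH, h.hw, hav.zw, hav.nmem, hav.wZ, hav.closed, ?_⟩
  have : ∀ k, G.Adj c k → k ∉ X ∧ k ≠ w := fun k hk =>
    ⟨fun e => hav.nadj k e hk, fun e => h.cw (e ▸ hk)⟩
  have h1 := this k hck
  have h2 := this l hcl
  by_cases hkg : k = g
  · exact ⟨l, hl, h2.1, by grind, h2.2⟩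
  · exact ⟨k, hk, h1.1, hkg, h1.2⟩

/-- The vertex `e` has no neighbours in `H` outside `X` other than `g` and `w`. -/
lemma Tail.Max.not_adj (h : Tail.Max G H c t w e b X g) {v : V} (hv : v ∈ H) (hvX : v ∉ X)
    (hvg : v ≠ g) (hvw : v ≠ w) : ¬ G.Adj e v := fun hev => by
  have := h.avoid.closed e h.eX v hv hev
  tauto

/-- Two neighbours of `w` outside `X` and different from `g` are adjacent. -/
lemma Tail.Max.adj (hG : NoClaw G) (h : Tail.Max G H c t w e b X g) {u v : V} (hu : u ∈ H)
    (huX : u ∉ X) (hug : u ≠ g) (hwu : G.Adj w u) (hv : v ∈ H) (hvX : v ∉ X)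
    (hvg : v ≠ g) (hwv : G.Adj w v) (huv : u ≠ v) : G.Adj u v := by
  have h1 := h.not_adj hu huX hug hwu.ne.symm
  have h2 := h.not_adj hv hvX hvg hwv.ne.symm
  have h3 : e ≠ u := fun h' => huX (h' ▸ h.eX)
  have h4 : e ≠ v := fun h' => hvX (h' ▸ h.eX)
  have := hG w e u v h.we hwu hwv h3 h4 huv
  tauto

lemma Tail.Max.eq_of_extend (h : Tail.Max G H c t w e b X g) {U : Finset V} {u : V}
    (hU : Frag G (tailSet H c t w) U u) (hXU : X ⊆ U) (hgU : g ∈ U) (hb : b ∉ U) (hc : c ∉ U)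
    (ht : t ∉ U) : False := by
  have h1 := h.max U u hU hXU hb hc ht
  have h2 := Finset.card_lt_card (s := X) (t := U) ⟨hXU, fun h' => h.frag.nmem (h' hgU)⟩
  omega

/-- Fragments avoiding the tail that are disjoint from `X` and `g` and are not adjacent to
`X`. -/
lemma Tail.Max.touch (h : Tail.Max G H c t w e b X g) {Y : Finset V} {y : V}
    (hY : Frag G (tailSet H c t w) Y y) (hXY : ∀ u ∈ Y, u ∉ X) (hc : c ∉ Y) (ht : t ∉ Y) :
    Y ⊆ H ∧ ∃ u ∈ Y, G.Adj w u := by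
  have := h.tail.avoid h.hw hY hc ht (h.avoid.sub h.eX) (fun h' => hXY e h' h.eX) h.we.ne.symm
  exact ⟨this.sub, this.touch⟩

/-- Fragments are sorted by containing `g`, meeting the tail, or neither. Two of the last kind have
adjacent neighbours of `w`. If all kinds occur, the first one joined with `X` is a larger fragment
still avoiding `b` and the tail, against maximality. -/
lemma Tail.Max.chain_sdiff (hG : NoClaw G) (h : Tail.Max G H c t w e b X g) :
    Chain G (tailSet H c t w \ X) := by
  have hconn := h.frag.conn_sdiff h.tail.conn
  have hgX := h.frag.nmem
  have lift : ∀ Y y, Frag G (tailSet H c t w \ X) Y y → g ∉ Y →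
      Frag G (tailSet H c t w) Y y := by
    intro Y y hY hg
    refine ⟨hY.sub.trans Finset.sdiff_subset, hY.ne, (Finset.mem_sdiff.1 hY.mem).1, hY.nmem,
      fun u hu v hv huv => ?_⟩
    have hus := Finset.mem_sdiff.1 (hY.sub hu)
    by_cases hvX : v ∈ X
    · rcases h.frag.closed v hvX u hus.1 huv.symm with h' | h'
      · exact absurd h' hus.2
      · exact absurd (h' ▸ hu) hg
    · exact hY.closed u hu v (Finset.mem_sdiff.2 ⟨hv, hvX⟩) huv
  have touch : ∀ Y y, Frag G (tailSet H c t w \ X) Y y → g ∉ Y → (c ∉ Y ∧ t ∉ Y) →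
      ∃ u ∈ Y, G.Adj w u ∧ u ∈ H ∧ u ∉ X ∧ u ≠ g := by
    intro Y y hY hg hct
    have hYX : ∀ u ∈ Y, u ∉ X := fun u hu => (Finset.mem_sdiff.1 (hY.sub hu)).2
    obtain ⟨h1, u, hu, hwu⟩ := h.touch (lift Y y hY hg) hYX hct.1 hct.2
    exact ⟨u, hu, hwu, h1 hu, hYX u hu, fun h' => hg (h' ▸ hu)⟩
  refine chain_of_classes (g ∈ ·) (fun Y => g ∉ Y ∧ ¬ (c ∉ Y ∧ t ∉ Y))
    (fun Y => g ∉ Y ∧ (c ∉ Y ∧ t ∉ Y)) hconn (fun _ _ _ => by tauto) ?_ ?_ ?_ ?_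
  · intro Y Z _ _ _ _ hYZ h1 h2
    exact (hYZ g h1 g h2).1 rfl
  · intro Y Z y z hY hZ hYZ h1 h2
    have hct := h.tail.adj
    have h3 := hct.symm
    have := hYZ c
    have := hYZ t
    grind
  · intro Y Z y z hY hZ hYZ h1 h2
    obtain ⟨u, hu, hwu, huH, huX, hug⟩ := touch Y y hY h1.1 h1.2
    obtain ⟨v, hv, hwv, hvH, hvX, hvg⟩ := touch Z z hZ h2.1 h2.2
    exact (hYZ u hu v hv).2 (h.adj hG huH huX hug hwu hvH hvX hvg hwv (hYZ u hu v hv).1)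
  · intro Y₁ Y₂ Y₃ y₁ y₂ y₃ h₁ h₂ h₃ h12 h13 h23 c₁ c₂ c₃
    obtain ⟨u, hu, hwu, huH, huX, hug⟩ := touch Y₃ y₃ h₃ c₃.1 c₃.2
    have hb : b ∉ Y₁ := by
      intro hb
      have := h13 b hb u hu
      exact this.2 (h.adj hG h.bH h.bX h.bg h.wb huH huX hug hwu this.1)
    have hc₁ : c ∉ Y₁ ∧ t ∉ Y₁ := by
      have hct := h.tail.adj
      have h3 := hct.symm
      have := h12 c
      have := h12 t
      grind
    have hX := h.frag.closed
    have hy₁ := Finset.mem_sdiff.1 h₁.mem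
    refine h.eq_of_extend (U := Y₁ ∪ X) (u := y₁) ⟨Finset.union_subset
      (h₁.sub.trans Finset.sdiff_subset) h.frag.sub, ⟨g, by simp [c₁]⟩, hy₁.1, ?_, ?_⟩
      Finset.subset_union_right (by simp [c₁]) (by simp [hb, h.bX]) (by simp [hc₁, h.cX])
      (by simp [hc₁, h.tX])
    · have := h₁.nmem
      simp [this, hy₁.2]
    · intro u hu v hv huv
      have h1 := hX u
      have h2 := h₁.closed u
      simp only [Finset.mem_union, Finset.mem_sdiff] at hu h1 h2 ⊢
      by_cases hvX : v ∈ X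
      · simp [hvX]
      · rcases hu with hu | hu
        · have := h2 hu v ⟨hv, hvX⟩ huv
          tauto
        · rcases h1 hu v hv huv with h' | h'
          · exact absurd h' hvX
          · simp [h', c₁]

lemma Tail.Max.clique (hG : NoClaw G) (h : Tail.Max G H c t w e b X g) :
    ∀ u ∈ tailSet H c t w \ X, ∀ v ∈ tailSet H c t w \ X, G.Adj g u → G.Adj g v → u ≠ v →
      G.Adj u v := by
  obtain ⟨x, hx, hxg⟩ := h.frag.touch h.tail.conn
  have key : ∀ u ∈ tailSet H c t w \ X, G.Adj g u → x ≠ u ∧ ¬ G.Adj x u := by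
    intro u hu hgu
    rw [Finset.mem_sdiff] at hu
    refine ⟨fun h' => hu.2 (h' ▸ hx), fun h' => ?_⟩
    rcases h.frag.closed x hx u hu.1 h' with h'' | h''
    · exact hu.2 h''
    · exact hgu.ne h''.symm
  intro u hu v hv hgu hgv huv
  have h1 := key u hu hgu
  have h2 := key v hv hgv
  have := hG g x u v hxg.symm hgu hgv h1.1 h2.1 huv
  tauto

lemma Tail.Max.touch_of_closed (h : Tail.Max G H c t w e b X g) {Z : Finset V}
    (hZ : Z ⊆ (tailSet H c t w \ X).erase g) (hne : Z.Nonempty)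
    (hcl : ∀ u ∈ Z, ∀ v ∈ (tailSet H c t w \ X).erase g, G.Adj u v → v ∈ Z) :
    ∃ u ∈ Z, G.Adj g u := by
  by_contra! hc
  have hsub : ∀ u ∈ Z, u ∈ tailSet H c t w ∧ u ∉ X ∧ u ≠ g := fun u hu => by
    have := hZ hu
    rw [Finset.mem_erase, Finset.mem_sdiff] at this
    tauto
  have := h.tail.conn (w := w) Z (fun u hu => (hsub u hu).1) hne (fun u hu v hv huv => by
    have hu' := hsub u hu
    refine hcl u hu v ?_ huv
    rw [Finset.mem_erase, Finset.mem_sdiff]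
    refine ⟨fun h' => hc u hu (h' ▸ huv.symm), hv, fun h' => ?_⟩
    have := h.frag.closed v h' u hu'.1 huv.symm
    tauto) g h.frag.mem
  exact (hsub g this).2.2 rfl

/-- Every closed part sees `g`, whose neighbours outside `X` form a clique. -/
lemma Tail.Max.conn_sdiff_erase (hG : NoClaw G) (h : Tail.Max G H c t w e b X g) :
    Conn G ((tailSet H c t w \ X).erase g) := by
  intro Z hZ hne hcl v hv
  by_contra hvZ
  obtain ⟨u, hu, hgu⟩ := h.touch_of_closed hZ hne hcl
  obtain ⟨u', hu', hgu'⟩ := h.touch_of_closed (Z := (tailSet H c t w \ X).erase g \ Z)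
    Finset.sdiff_subset ⟨v, Finset.mem_sdiff.2 ⟨hv, hvZ⟩⟩ (fun a ha a' ha' haa' => by
      rw [Finset.mem_sdiff] at ha ⊢
      exact ⟨ha', fun h' => ha.2 (hcl a' h' a ha.1 haa'.symm)⟩)
  rw [Finset.mem_sdiff] at hu'
  have huu : u ≠ u' := fun h' => hu'.2 (h' ▸ hu)
  exact hu'.2 (hcl u hu u' hu'.1 (h.clique hG u (Finset.mem_of_mem_erase (hZ hu)) u'
    (Finset.mem_of_mem_erase hu'.1) hgu hgu' huu))

/-- With `g` deleted, having a neighbour of `g` replaces containing `g`. The extension that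
contradicts maximality is the first fragment with `X` and `g`. -/
lemma Tail.Max.chain_sdiff_erase (hG : NoClaw G) (h : Tail.Max G H c t w e b X g) :
    Chain G ((tailSet H c t w \ X).erase g) := by
  have hconn := h.conn_sdiff_erase hG
  have hgX := h.frag.nmem
  have hmem : ∀ Y y, Frag G ((tailSet H c t w \ X).erase g) Y y → ∀ u ∈ Y,
      u ∈ tailSet H c t w ∧ u ∉ X ∧ u ≠ g := fun Y y hY u hu => by
    have := hY.sub hu
    rw [Finset.mem_erase, Finset.mem_sdiff] at this
    tauto
  have lift : ∀ Y y, Frag G ((tailSet H c t w \ X).erase g) Y y → (∀ u ∈ Y, ¬ G.Adj g u) →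
      Frag G (tailSet H c t w) Y y := by
    intro Y y hY hg
    have hy := hY.mem
    rw [Finset.mem_erase, Finset.mem_sdiff] at hy
    refine ⟨fun u hu => (hmem Y y hY u hu).1, hY.ne, hy.2.1, hY.nmem, fun u hu v hv huv => ?_⟩
    have hus := hmem Y y hY u hu
    refine hY.closed u hu v ?_ huv
    rw [Finset.mem_erase, Finset.mem_sdiff]
    refine ⟨fun h' => hg u hu (h' ▸ huv.symm), hv, fun hvX => ?_⟩
    have := h.frag.closed v hvX u hus.1 huv.symm
    tauto
  have touch : ∀ Y y, Frag G ((tailSet H c t w \ X).erase g) Y y → (∀ u ∈ Y, ¬ G.Adj g u) →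
      (c ∉ Y ∧ t ∉ Y) → ∃ u ∈ Y, G.Adj w u ∧ u ∈ H ∧ u ∉ X ∧ u ≠ g := by
    intro Y y hY hg hct
    obtain ⟨h1, u, hu, hwu⟩ := h.touch (lift Y y hY hg) (fun u hu => (hmem Y y hY u hu).2.1)
      hct.1 hct.2
    exact ⟨u, hu, hwu, h1 hu, (hmem Y y hY u hu).2⟩
  refine chain_of_classes (fun Y => ∃ u ∈ Y, G.Adj g u)
    (fun Y => (∀ u ∈ Y, ¬ G.Adj g u) ∧ ¬ (c ∉ Y ∧ t ∉ Y))
    (fun Y => (∀ u ∈ Y, ¬ G.Adj g u) ∧ (c ∉ Y ∧ t ∉ Y)) hconn (fun Y _ _ => ?_) ?_ ?_ ?_ ?_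
  · by_cases h1 : ∃ u ∈ Y, G.Adj g u
    · exact Or.inl h1
    · push Not at h1
      tauto
  · rintro Y Z y z hY hZ hYZ ⟨u, hu, hgu⟩ ⟨v, hv, hgv⟩
    have h1 := hYZ u hu v hv
    exact h1.2 (h.clique hG u (Finset.mem_of_mem_erase (hY.sub hu)) v
      (Finset.mem_of_mem_erase (hZ.sub hv)) hgu hgv h1.1)
  · intro Y Z y z hY hZ hYZ h1 h2
    have hct := h.tail.adj
    have h3 := hct.symm
    have := hYZ c
    have := hYZ t
    grind
  · intro Y Z y z hY hZ hYZ h1 h2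
    obtain ⟨u, hu, hwu, huH, huX, hug⟩ := touch Y y hY h1.1 h1.2
    obtain ⟨v, hv, hwv, hvH, hvX, hvg⟩ := touch Z z hZ h2.1 h2.2
    exact (hYZ u hu v hv).2 (h.adj hG huH huX hug hwu hvH hvX hvg hwv (hYZ u hu v hv).1)
  · intro Y₁ Y₂ Y₃ y₁ y₂ y₃ h₁ h₂ h₃ h12 h13 h23 c₁ c₂ c₃
    obtain ⟨u, hu, hwu, huH, huX, hug⟩ := touch Y₃ y₃ h₃ c₃.1 c₃.2
    obtain ⟨a, ha, hga⟩ := c₁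
    have hb : b ∉ Y₁ := by
      intro hb
      have := h13 b hb u hu
      exact this.2 (h.adj hG h.bH h.bX h.bg h.wb huH huX hug hwu this.1)
    have hc₁ : c ∉ Y₁ ∧ t ∉ Y₁ := by
      have hct := h.tail.adj
      have h3 := hct.symm
      have := h12 c
      have := h12 t
      grind
    have hgH := h.avoid.zH
    have hgc : c ≠ g := fun h' => h.tail.cH (h' ▸ hgH)
    have hgt : t ≠ g := fun h' => h.tail.tH (h' ▸ hgH)
    have hX := h.frag.closed
    have hy₁ := h₁.mem
    have hy₁' := h₁.nmem
    rw [Finset.mem_erase, Finset.mem_sdiff] at hy₁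
    refine h.eq_of_extend (U := insert g (Y₁ ∪ X)) (u := y₁) ⟨?_, ⟨g, by simp⟩, hy₁.2.1, ?_, ?_⟩
      (Finset.subset_union_right.trans (Finset.subset_insert _ _)) (by simp)
      (by simp [hb, h.bX, h.bg]) (by simp only [Finset.mem_insert, Finset.mem_union, hgc, hc₁.1,
        h.cX, or_self, not_false_eq_true]) (by simp only [Finset.mem_insert, Finset.mem_union, hgt,
        hc₁.2, h.tX, or_self, not_false_eq_true])
    · exact Finset.insert_subset h.frag.mem (Finset.union_subset
        (fun u hu => (hmem _ _ h₁ u hu).1) h.frag.sub)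
    · simp only [Finset.mem_insert, Finset.mem_union]
      tauto
    · intro u hu v hv huv
      simp only [Finset.mem_insert, Finset.mem_union] at hu ⊢
      by_cases hvX : v ∈ X
      · simp [hvX]
      by_cases hvg : v = g
      · simp [hvg]
      have hv' : v ∈ (tailSet H c t w \ X).erase g := by
        rw [Finset.mem_erase, Finset.mem_sdiff]
        exact ⟨hvg, hv, hvX⟩
      rcases hu with rfl | hu | hu
      · by_cases hav : a = v
        · subst hav; simp [ha]
        · have := h.clique hG a (Finset.mem_of_mem_erase (h₁.sub ha)) v
            (Finset.mem_of_mem_erase hv') hga huv hav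
          have := h₁.closed a ha v hv' this
          tauto
      · have := h₁.closed u hu v hv' huv
        tauto
      · have := hX u hu v hv huv
        tauto

lemma Tail.Max.chain_insert (h : Tail.Max G H c t w e b X g) :
    Chain G (insert w (tailSet H c t w \ X)) := by
  have hbw := h.wb.ne.symm
  have hbS : b ∈ tailSet H c t w \ X := by
    have := h.bH
    have := h.bX
    rw [Finset.mem_sdiff]
    exact ⟨by simp [h.bH, hbw], h.bX⟩
  have hconn := (h.frag.conn_sdiff h.tail.conn).insert hbS h.wb
  have hgX := h.frag.nmem
  have hXH := h.avoid.sub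
  have hwX := h.avoid.wZ
  have hct := h.tail.adj
  have hct' := hct.symm
  refine chain_of_classes (g ∈ ·) (w ∈ ·) (fun Y => ¬ (c ∉ Y ∧ t ∉ Y)) hconn ?_ ?_ ?_ ?_ ?_
  · intro Y y hY
    by_contra! hc
    obtain ⟨hgY, hwY, hcY, htY⟩ := hc
    have hYH : ∀ u ∈ Y, u ∈ H ∧ u ∉ X := by
      intro u hu
      have := hY.sub hu
      rw [Finset.mem_insert, Finset.mem_sdiff] at this
      grind
    -- A fragment in none of the three classes would be cut off from `e` in `H` by a single vertex.
    have := h.tail.conn2.2 Y (fun u hu => (hYH u hu).1) hY.ne y hY.nmem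
      (fun u hu v hv huv => by
        refine hY.closed u hu v ?_ huv
        rw [Finset.mem_insert, Finset.mem_sdiff]
        by_cases hvw : v = w
        · exact Or.inl hvw
        · refine Or.inr ⟨by simp [hv, hvw], fun hvX => ?_⟩
          have := h.avoid.closed v hvX u (hYH u hu).1 huv.symm
          grind) e (hXH h.eX)
    rcases this with h' | rfl
    · exact (hYH e h').2 h.eX
    · have := hY.mem
      rw [Finset.mem_insert, Finset.mem_sdiff] at this
      rcases this with h' | h'
      · exact h.we.ne h'.symm
      · exact h'.2 h.eX
  · intro Y Z _ _ _ _ hYZ h1 h2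
    exact (hYZ g h1 g h2).1 rfl
  · intro Y Z _ _ _ _ hYZ h1 h2
    exact (hYZ w h1 w h2).1 rfl
  · intro Y Z y z hY hZ hYZ h1 h2
    have := hYZ c
    have := hYZ t
    grind
  · intro Y₁ Y₂ Y₃ y₁ y₂ y₃ h₁ h₂ h₃ h12 h13 h23 c₁ c₂ c₃
    have hb : b ∉ Y₁ := fun hb => (h12 b hb w c₂).2 h.wb.symm
    have hw₁ : w ∉ Y₁ := fun hw => (h12 w hw w c₂).1 rfl
    have hc₁ : c ∉ Y₁ ∧ t ∉ Y₁ := by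
      have := h13 c
      have := h13 t
      grind
    have hyw : y₁ ≠ w := by
      rintro rfl
      obtain ⟨u, hu, huy⟩ := h₁.touch hconn
      exact (h12 u hu y₁ c₂).2 huy
    have hX := h.frag.closed
    have hy₁ := h₁.mem
    have hy₁' := h₁.nmem
    rw [Finset.mem_insert, Finset.mem_sdiff] at hy₁
    have hy₂ := hy₁.resolve_left hyw
    refine h.eq_of_extend (U := Y₁ ∪ X) (u := y₁) ⟨Finset.union_subset (fun u hu => ?_)
      h.frag.sub, ⟨g, by simp [c₁]⟩, hy₂.1, ?_, ?_⟩ Finset.subset_union_right (by simp [c₁])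
      (by simp [hb, h.bX]) (by simp [hc₁, h.cX]) (by simp [hc₁, h.tX])
    · have := h₁.sub hu
      rw [Finset.mem_insert, Finset.mem_sdiff] at this
      rcases this with rfl | h'
      · exact absurd hu hw₁
      · exact h'.1
    · simp [hy₁', hy₂.2]
    · intro u hu v hv huv
      rw [Finset.mem_union] at hu ⊢
      by_cases hvX : v ∈ X
      · simp [hvX]
      · rcases hu with hu | hu
        · have := h₁.closed u hu v (by rw [Finset.mem_insert, Finset.mem_sdiff]; tauto) huv
          tauto
        · rcases hX u hu v hv huv with h' | h'
          · exact absurd h' hvX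
          · simp [h', c₁]

end

/-- Residue 0 of `X` separates `X` from the rest, and residue 2 moves `g` to `X`. For residue 1, `e`
is deleted in place of `w`: either `w` has another neighbour in `X` and `hch` applies, or `X - e`
separates from the rest with `w` restored. -/
lemma Tail.Max.hasFactor {H X : Finset V} {c t w e b g : V} {n : ℕ} (hG : NoClaw G)
    (h : Tail.Max G H c t w e b X g) (ih : FactorBelow G n) (hn : H.card + 1 < n)
    (h3 : H.card % 3 = 2)
    (hch : ∀ f ∈ X, f ≠ e → G.Adj w f → Chain G (tailSet H c t e)) :
    HasFactor G (tailSet H c t w) ∨ HasFactor G (tailSet H c t e) := by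
  have hav := h.avoid
  have hleg := h.leg
  have hXH := hav.sub
  have heH := hXH h.eX
  have c1 := h.tail.card h.hw
  have c2 := h.tail.card heH
  have c3 := Finset.card_sdiff_add_card_eq_card h.frag.sub
  have c4 := h.frag.ne.card_pos
  have hgS : g ∈ tailSet H c t w \ X := Finset.mem_sdiff.2 ⟨h.frag.mem, h.frag.nmem⟩
  have hXS := h.frag.sub
  have hgX := h.frag.nmem
  have hgS' := h.frag.mem
  by_cases hx0 : X.card % 3 = 0
  · left
    refine (ih X (by omega) (hleg.chain hG h.tail.conn2) hx0).union
      (ih _ (by omega) (h.chain_sdiff hG) (by omega)) (fun v hv => by simp [hv]) fun v => ?_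
    rw [Finset.mem_sdiff]
    have := @hXS v
    tauto
  by_cases hx2 : X.card % 3 = 2
  · left
    have c5 : (insert g X).card = X.card + 1 := Finset.card_insert_of_notMem hgX
    have c6 := Finset.card_erase_add_one hgS
    refine (ih (insert g X) (by omega) (hleg.chain_insert hG h.tail.conn2) (by omega)).union
      (ih _ (by omega) (h.chain_sdiff_erase hG) (by omega)) (fun v hv => ?_) fun v => ?_
    · rw [Finset.mem_insert] at hv
      rw [Finset.mem_erase, Finset.mem_sdiff]
      tauto
    · rw [Finset.mem_insert (s := X), Finset.mem_erase, Finset.mem_sdiff]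
      have := @hXS v
      by_cases hvg : v = g
      · subst hvg; tauto
      · tauto
  right
  by_cases hf : ∃ f ∈ X, f ≠ e ∧ G.Adj w f
  · obtain ⟨f, hf, hfe, hwf⟩ := hf
    exact ih _ (by omega) (hch f hf hfe hwf) (by omega)
  · push Not at hf
    have hwe := h.we.ne
    have hge : g ≠ e := fun h' => hgX (h' ▸ h.eX)
    have c5 := Finset.card_erase_add_one h.eX
    have hwS : w ∉ tailSet H c t w \ X := by
      have h1 : w ≠ c := fun h' => h.tail.cH (h' ▸ h.hw)
      have h2 : w ≠ t := fun h' => h.tail.tH (h' ▸ h.hw)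
      simp [h1, h2]
    have c6 := Finset.card_insert_of_notMem hwS
    have hF1 : HasFactor G (X.erase e) := by
      by_cases hne : (X.erase e).Nonempty
      · refine ih _ (by omega) (Leg.chain (H := H) (p := e) (q := g) hG h.tail.conn2 ⟨?_, hne,
          heH, hav.zH, hge.symm, by simp, fun h' => hgX (Finset.mem_of_mem_erase h'), ?_,
          w, h.hw, fun h' => hav.wZ (Finset.mem_of_mem_erase h'), hwe, hav.zw.symm⟩) (by omega)
        · exact (Finset.erase_subset _ _).trans hXH
        · intro u hu v hv huv
          rw [Finset.mem_erase] at hu ⊢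
          have h1 := hav.closed u hu.2 v hv huv
          have h2 : v ≠ w := by
            rintro rfl
            exact hf u hu.2 hu.1 huv.symm
          tauto
      · rw [Finset.not_nonempty_iff_eq_empty] at hne
        rw [hne]
        exact .empty
    refine hF1.union (ih _ (by omega) h.chain_insert (by omega)) (fun v hv => ?_) fun v => ?_
    · rw [Finset.mem_erase] at hv
      rw [Finset.mem_insert, Finset.mem_sdiff]
      have : v ≠ w := fun h' => hav.wZ (h' ▸ hv.2)
      tauto
    · have h1 := h.eX
      have h2 := h.hw
      have h4 : v ∈ X → v ∈ H := fun h' => hXH h'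
      have h5 := h.tail.cH
      have h6 := h.tail.tH
      have h7 := h.cX
      have h8 := h.tX
      simp only [Finset.mem_insert, Finset.mem_sdiff, Finset.mem_erase]
      grind

/-- The minimal `X` is enlarged to a maximal fragment `U` missing `b` and the tail. By a claw at `w`
with `b`, any further neighbour `f` of `w` in `U` is adjacent to `e`, hence lies in `X + g`, as
`Tail.chain_of_minFrag` needs. -/
lemma Tail.hasFactor_of_minFrag {H X Y : Finset V} {c t w e b g d : V} {n : ℕ} (hG : NoClaw G)
    (h : Tail G H c t) (ih : FactorBelow G n) (hn : H.card + 1 < n) (h3 : H.card % 3 = 2)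
    (hw : w ∈ H) (hX : MinFrag G (tailSet H c t w) X g) (hY : MinFrag G (tailSet H c t w) Y d)
    (hXY : Apart G X Y) (hcX : c ∉ X) (htX : t ∉ X) (hcY : c ∉ Y) (htY : t ∉ Y) (he : e ∈ X)
    (hwe : G.Adj w e) (hb : b ∈ Y) (hwb : G.Adj w b) :
    HasFactor G (tailSet H c t w) ∨ HasFactor G (tailSet H c t e) := by
  have hYH : ∀ u ∈ Y, u ∈ H ∧ u ≠ w := fun u hu => by
    have := hY.1.sub hu
    grind
  have hXH : ∀ u ∈ X, u ∈ H ∧ u ≠ w := fun u hu => by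
    have := hX.1.sub hu
    grind
  have hbX : b ∉ X := fun h' => (hXY b h' b hb).1 rfl
  have heY : e ∉ Y := fun h' => (hXY e he e h').1 rfl
  have hav := h.avoid hw hX.1 hcX htX (hYH b hb).1 hbX (hYH b hb).2
  have hav' := h.avoid hw hY.1 hcY htY (hXH e he).1 heY (hXH e he).2
  have hcw := hav.not_adj hG hav' hXY h.cH
  obtain ⟨U, u, hU, ⟨hXU, hbU, hcU, htU⟩, hmax⟩ := hX.1.exists_max
    (fun U => X ⊆ U ∧ b ∉ U ∧ c ∉ U ∧ t ∉ U) ⟨subset_rfl, hbX, hcX, htX⟩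
  have hcS : c ∈ tailSet H c t w := by simp
  have hdisj := hY.disjoint h.conn hU hcS hcY hcU hb hbU (hXU he) heY
  have hnadj := hU.not_adj h.conn hY.1 hdisj.symm hcS hcU hcY
  have hbu : b ≠ u := by
    rintro rfl
    obtain ⟨v, hv, hvb⟩ := hU.touch h.conn
    exact hnadj v hv b hb hvb
  have hM : Tail.Max G H c t w e b U u := ⟨h, hw, hU, hcU, htU, hXU he, hwe, (hYH b hb).1, hbU, hbu,
    hwb, hcw, fun W v hW h1 h2 h3 h4 => hmax W v hW ⟨hXU.trans h1, h2, h3, h4⟩⟩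
  refine hM.hasFactor hG ih hn h3 fun f hf hfe hwf => ?_
  have hef : G.Adj e f := by
    have hfb : f ≠ b := fun h' => hbU (h' ▸ hf)
    have h1 := hXY e he b hb
    have h2 := hnadj f hf b hb
    have := hG w e f b hwe hwf hwb hfe.symm h1.1 hfb
    tauto
  have hfX := hX.1.closed e he f (hU.sub hf) hef
  have hbg : b ≠ g := by
    rintro rfl
    obtain ⟨v, hv, hvb⟩ := hX.1.touch h.conn
    exact (hXY v hv b hb).2 hvb
  exact h.chain_of_minFrag hG hw hX hav hcw he hwe hfX hfe hwf (hYH b hb).1 hbX hbg hwb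

/-- A set without cut vertices with two tails `s - a` and `t - c` attached has a factor. -/
lemma Tail.hasFactor {A H : Finset V} {c t a s w : V} (hG : NoClaw G)
    (h : Tail G H c t) (ih : FactorBelow G A.card) (h3 : H.card % 3 = 2) (hsH : s ∉ H)
    (haH : a ∉ H) (hsa : G.Adj s a) (hsc : s ≠ c) (hst : s ≠ t) (hac : a ≠ c) (hat : a ≠ t)
    (hA : ∀ v, v ∈ A ↔ v ∈ H ∨ v = s ∨ v = a ∨ v = c ∨ v = t) (hw : w ∈ H) (haw : G.Adj a w) :
    HasFactor G A := by
  have hcH := h.cH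
  have htH := h.tH
  have hct := h.adj.ne
  have hsa' := hsa.ne
  have hn : H.card + 1 < A.card := by
    have hss : tailSet H c t w ⊆ (A.erase s).erase a := fun v hv => by
      have := hA v
      grind
    have h1 := Finset.card_le_card hss
    have h2 := h.card hw
    have h4 := Finset.card_erase_add_one (s := A) (a := s) ((hA s).2 (by simp))
    have h5 := Finset.card_erase_add_one (s := A.erase s) (a := a)
      (Finset.mem_erase.2 ⟨hsa'.symm, (hA a).2 (by simp)⟩)
    omega
  have fin : ∀ e ∈ H, G.Adj a e → HasFactor G (tailSet H c t e) → HasFactor G A := by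
    intro e he hae hF
    have hse : s ≠ e := fun h' => hsH (h' ▸ he)
    refine hF.add hsa hae hse ?_ ?_ ?_ fun v => ?_
    · simp [hsH, hsc, hst]
    · simp [haH, hac, hat]
    · have h1 : e ≠ c := fun h' => hcH (h' ▸ he)
      have h2 : e ≠ t := fun h' => htH (h' ▸ he)
      simp [h1, h2]
    · rw [hA v]
      simp only [Finset.mem_insert, Finset.mem_erase]
      by_cases hv : v = e
      · simp [hv, he]
      · simp only [hv, ne_eq, not_false_eq_true, true_and, false_or]
        tauto
  by_cases hS : Chain G (tailSet H c t w)
  · have := h.card hw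
    exact fin w hw haw (ih _ (by omega) hS (by omega))
  obtain ⟨X', x', Y', y', hX', hY', hXY', h1, h2, h4, h5, hav, hav'⟩ := h.exists_pair hw hS
  obtain ⟨X, x, hX, hXX⟩ := hX'.exists_min
  obtain ⟨Y, y, hY, hYY⟩ := hY'.exists_min
  have hXY : Apart G X Y := fun u hu v hv => hXY' u (hXX hu) v (hYY hv)
  have key : ∀ X x Y y, MinFrag G (tailSet H c t w) X x → Frag G (tailSet H c t w) Y y →
      Apart G X Y → (c ∉ X ∧ t ∉ X) → (c ∉ Y ∧ t ∉ Y) → ∃ u ∈ X, u ∈ H ∧ G.Adj w u := by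
    intro X x Y y hX hY hXY hc hc'
    obtain ⟨o, ho⟩ := hY.ne
    have hoH : o ∈ H ∧ o ≠ w := by
      have := hY.sub ho
      grind
    have := h.avoid hw hX.1 hc.1 hc.2 hoH.1 (fun h' => (hXY o h' o ho).1 rfl) hoH.2
    obtain ⟨u, hu, hwu⟩ := this.touch
    exact ⟨u, hu, this.sub hu, hwu⟩
  have hXct : c ∉ X ∧ t ∉ X := ⟨fun h' => h1 (hXX h'), fun h' => h2 (hXX h')⟩
  have hYct : c ∉ Y ∧ t ∉ Y := ⟨fun h' => h4 (hYY h'), fun h' => h5 (hYY h')⟩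
  obtain ⟨e, he, heH, hwe⟩ := key X x Y y hX hY.1 hXY hXct hYct
  obtain ⟨b, hb, hbH, hwb⟩ := key Y y X x hY hX.1 hXY.symm hYct hXct
  have heb := hXY e he b hb
  have hae : a ≠ e := fun h' => haH (h' ▸ heH)
  have hab : a ≠ b := fun h' => haH (h' ▸ hbH)
  -- Since `e` and `b` are nonadjacent, `a` is adjacent to one of them, and that vertex can replace
  -- `w` on the path from `s`.
  rcases hG w a e b haw.symm hwe hwb hae hab heb.1 with h' | h' | h'
  · rcases h.hasFactor_of_minFrag hG ih hn h3 hw hX hY hXY hXct.1 hXct.2 hYct.1 hYct.2 he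
      hwe hb hwb with hF | hF
    · exact fin w hw haw hF
    · exact fin e heH h' hF
  · rcases h.hasFactor_of_minFrag hG ih hn h3 hw hY hX hXY.symm hYct.1 hYct.2 hXct.1 hXct.2
      hb hwb he hwe with hF | hF
    · exact fin w hw haw hF
    · exact fin b hbH h' hF
  · exact absurd h' heb.2

/-! ### A leaf at a cut vertex -/

/-- If no factor exists, earlier cases leave only trivial fragments. Thus `Q` is a single vertex `t`
and `P` has no cut vertex, so `A` is `P` with the tails `s - c` and `t - d`. -/
lemma Split.factor_of_leaf_of_not_touch {A X Y P Q : Finset V} {c d : V} (hG : NoClaw G)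
    (hA : Chain G A) (ih : FactorBelow G A.card) (h : Split G A X Y c) (h3 : A.card % 3 = 0)
    (hX : X.card = 1) (hPQ : Split G Y P Q d) (hQ : ∀ u ∈ Q, ¬ G.Adj c u) : HasFactor G A := by
  by_contra hF
  have hYc := h.symm.chain_left hG hA
  have hPc := hPQ.conn_left hYc
  -- a fragment of `A` with two vertices outside cannot contain two vertices
  have small : ∀ Z z, Frag G A Z z → 1 < Z.card → ∀ o ∈ A, ∀ o' ∈ A, o ∉ Z → o' ∉ Z → o ≠ z →
      o' ≠ z → o ≠ o' → False := by
    intro Z z hZ hZc o ho o' ho' hoZ hoZ' hoz hoz' hoo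
    have hs := Split.of_frag hZ ho hoZ hoz
    rcases hs.factor hG hA ih h3 with h' | h' | h'
    · exact hF h'
    · omega
    · obtain ⟨r, hr⟩ := Finset.card_eq_one.1 h'
      have h1 : o ∈ ({r} : Finset V) := by rw [← hr]; grind
      have h2 : o' ∈ ({r} : Finset V) := by rw [← hr]; grind
      rw [Finset.mem_singleton] at h1 h2
      exact hoo (h1.trans h2.symm)
  obtain ⟨s, rfl⟩ := Finset.card_eq_one.1 hX
  have hsA : s ∈ A := h.left.sub (by simp)
  have hcA := h.left.mem
  have hcs : s ≠ c := fun h' => h.left.nmem (by simp [h'])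
  have hYA := h.right.sub
  have hcY := h.right.nmem
  have hsY : s ∉ Y := h.disj s (by simp)
  have hPY := hPQ.left.sub
  have hQY := hPQ.right.sub
  have hdY := hPQ.left.mem
  have hdP := hPQ.left.nmem
  have hdQ := hPQ.right.nmem
  have hsc : G.Adj s c := by
    obtain ⟨u, hu, huc⟩ := h.left.touch hA.1
    rw [Finset.mem_singleton] at hu
    exact hu ▸ huc
  have hsnb : ∀ v ∈ A, G.Adj s v → v = c := by
    intro v hv hsv
    have := h.left.closed s (by simp) v hv hsv
    have := hsv.ne
    grind
  have hcl := h.symm.clique hG hA.1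
  have hQA : Frag G A Q d := by
    refine ⟨hQY.trans hYA, hPQ.right.ne, hYA hdY, hdQ, fun u hu v hv huv => ?_⟩
    rcases h.right.closed u (hQY hu) v hv huv with h' | rfl
    · exact hPQ.right.closed u hu v h' huv
    · exact absurd huv.symm (hQ u hu)
  have hQ1 : Q.card = 1 := by
    by_contra hQ1
    have := hPQ.symm.pos_left
    exact small Q d hQA (by omega) s hsA c hcA (fun h' => hsY (hQY h')) (fun h' => hcY (hQY h'))
      (fun h' => hsY (h' ▸ hdY)) (fun h' => hcY (h' ▸ hdY)) hcs
  obtain ⟨t, rfl⟩ := Finset.card_eq_one.1 hQ1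
  have htY : t ∈ Y := hQY (by simp)
  have hdt : G.Adj t d := by
    obtain ⟨u, hu, hud⟩ := hPQ.right.touch hYc.1
    rw [Finset.mem_singleton] at hu
    exact hu ▸ hud
  have htP : t ∉ P := fun h' => hPQ.disj t h' (by simp)
  have htd := hdt.ne
  have hct : ¬ G.Adj c t := hQ t (by simp)
  have hPn : ∀ u ∈ P, ∀ v ∈ A, G.Adj u v → v ∈ P ∨ v = d ∨ v = c := by
    intro u hu v hv huv
    rcases h.right.closed u (hPY hu) v hv huv with h' | h'
    · have := hPQ.left.closed u hu v h' huv
      tauto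
    · exact Or.inr (Or.inr h')
  have hcn : ∀ v ∈ A, G.Adj c v → v = s ∨ v ∈ P ∨ v = d := by
    intro v hv hcv
    rcases h.cover v hv with h' | h' | h'
    · simp at h'; simp [h']
    · rcases hPQ.cover v h' with h'' | h'' | h''
      · simp [h'']
      · exact absurd hcv (hQ v h'')
      · simp [h'']
    · exact absurd h'.symm hcv.ne
  -- if `c` and `d` are adjacent, then neighbours of `c` in `P` are neighbours of `d`
  have hcd : G.Adj c d → ∀ u ∈ P, G.Adj c u → G.Adj d u := by
    intro hcd u hu hcu
    exact hcl d hdY u (hPY hu) hcd hcu (fun h' => hdP (h' ▸ hu))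
  -- no part of `P` is a third fragment of `A`
  have third : ∀ N v, N ⊆ P → N.Nonempty → v ∈ P → v ∉ N →
      (∀ u ∈ N, ∀ x ∈ P, G.Adj u x → x ∈ N ∨ x = v) → (∀ u ∈ N, ¬ G.Adj c u) →
      (∀ u ∈ N, ¬ G.Adj d u) → False := by
    intro N v hNP hne hv hvN hN hNc hNd
    refine hA.2 _ _ N _ _ v h.left hQA ⟨(hNP.trans hPY).trans hYA, hne, hYA (hPY hv), hvN,
      fun u hu x hx hux => ?_⟩ ?_ ?_ ?_
    · rcases hPn u (hNP hu) x hx hux with h' | rfl | rfl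
      · exact hN u hu x h' hux
      · exact absurd hux.symm (hNd u hu)
      · exact absurd hux.symm (hNc u hu)
    · rw [Finset.disjoint_singleton]
      exact fun h' => hsY (h' ▸ htY)
    · rw [Finset.disjoint_singleton_left]
      exact fun h' => hsY (hPY (hNP h'))
    · rw [Finset.disjoint_singleton_left]
      exact fun h' => htP (hNP h')
  have hP2 : Conn2 G P := by
    by_contra hP2
    obtain ⟨M, N, v, hMN⟩ := hPc.exists_split hP2
    -- If `N` sees neither `c` nor `d`, it is a third fragment besides `{s}` and `{t}`. If it sees
    -- `c`, then `N` with `s` and `c` is a fragment at `v` leaving `t` and `d` outside, against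
    -- `small`.
    have side : ∀ M N, Split G P M N v → (∀ u ∈ N, ¬ G.Adj d u) → False := by
      intro M N hMN hN
      have hNP := hMN.right.sub
      have hvP := hMN.right.mem
      by_cases hNc : ∀ u ∈ N, ¬ G.Adj c u
      · exact third N v hNP hMN.right.ne hvP hMN.right.nmem hMN.right.closed hNc hN
      push Not at hNc
      obtain ⟨n, hn, hcn'⟩ := hNc
      have hcd' : ¬ G.Adj c d := fun h' => hN n hn (hcd h' n (hNP hn) hcn')
      have hMc : ∀ u ∈ M, ¬ G.Adj c u := by
        intro u hu hcu
        have hne : n ≠ u := fun h' => hMN.disj u hu (h' ▸ hn)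
        have hadj := hcl n (hPY (hNP hn)) u (hPY (hMN.left.sub hu)) hcn' hcu hne
        rcases hMN.right.closed n hn u (hMN.left.sub hu) hadj with h' | h'
        · exact hMN.disj u hu h'
        · exact hMN.left.nmem (h' ▸ hu)
      have hcN : c ∉ N := fun h' => hcY (hPY (hNP h'))
      have hsN : s ∉ N := fun h' => hsY (hPY (hNP h'))
      have hvc : v ≠ c := fun h' => hcY (h' ▸ hPY hvP)
      have hvs : v ≠ s := fun h' => hsY (h' ▸ hPY hvP)
      have hcard : (insert s (insert c N)).card = N.card + 2 := by
        rw [Finset.card_insert_of_notMem (by simp [hcs, hsN]), Finset.card_insert_of_notMem hcN]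
      have hNv := hMN.right.nmem
      have htN : t ∉ N := fun h' => htP (hNP h')
      have hdN : d ∉ N := fun h' => hdP (hNP h')
      refine small (insert s (insert c N)) v ⟨?_, by simp, hYA (hPY hvP), by simp [*], ?_⟩
        (by omega) t (hYA htY) d (hYA hdY) ?_ ?_ (fun h' => htP (h' ▸ hvP))
        (fun h' => hdP (h' ▸ hvP)) htd
      · exact Finset.insert_subset hsA (Finset.insert_subset hcA ((hNP.trans hPY).trans hYA))
      · intro u hu x hx hux
        simp only [Finset.mem_insert] at hu ⊢
        rcases hu with rfl | rfl | hu
        · simp [hsnb x hx hux]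
        · rcases hcn x hx hux with h' | h' | rfl
          · simp [h']
          · rcases hMN.cover x h' with h'' | h'' | h''
            · exact absurd hux (hMc x h'')
            · simp [h'']
            · simp [h'']
          · exact absurd hux hcd'
        · rcases hPn u (hNP hu) x hx hux with h' | rfl | rfl
          · have := hMN.right.closed u hu x h' hux
            tauto
          · exact absurd hux.symm (hN u hu)
          · simp
      · have h1 : t ≠ s := fun h' => hsY (h' ▸ htY)
        have h2 : t ≠ c := fun h' => hcY (h' ▸ htY)
        simp [h1, h2, htN]
      · have h1 : d ≠ s := fun h' => hsY (h' ▸ hdY)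
        have h2 : d ≠ c := fun h' => hcY (h' ▸ hdY)
        simp [h1, h2, hdN]
    by_cases hN : ∀ u ∈ N, ¬ G.Adj d u
    · exact side M N hMN hN
    -- The neighbours of `d` in `P` form a clique, so `d` misses one of the two parts.
    · refine side N M hMN.symm fun u hu hdu => ?_
      push Not at hN
      obtain ⟨n, hn, hdn⟩ := hN
      have hne : u ≠ n := fun h' => hMN.disj u hu (h' ▸ hn)
      have hadj := hPQ.clique hG hYc.1 u (hMN.left.sub hu) n (hMN.right.sub hn) hdu hdn hne
      rcases hMN.left.closed u hu n (hMN.right.sub hn) hadj with h' | h'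
      · exact hMN.disj n h' hn
      · exact hMN.right.nmem (h' ▸ hn)
  have hcard := h.card
  have hcard' := hPQ.card
  have hP3 : P.card % 3 = 2 := by omega
  have hw : ∃ w ∈ P, G.Adj c w := by
    by_contra! hw
    obtain ⟨p, hp⟩ := hPQ.left.ne
    have hsc' : ∀ o ∈ Y, o ∉ ({s, c} : Finset V) := fun o ho h' => by
      simp only [Finset.mem_insert, Finset.mem_singleton] at h'
      rcases h' with rfl | rfl
      exacts [hsY ho, hcY ho]
    refine small {s, c} d ⟨?_, by simp, hYA hdY, ?_, ?_⟩ (by rw [Finset.card_pair hcs]; omega)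
      t (hYA htY) p (hYA (hPY hp)) (hsc' t htY) (hsc' p (hPY hp)) htd
      (fun h'' => hdP (h'' ▸ hp)) (fun h'' => htP (h'' ▸ hp))
    · exact Finset.insert_subset hsA (by simpa using hcA)
    · have h1 : d ≠ s := fun h' => hsY (h' ▸ hdY)
      have h2 : d ≠ c := fun h' => hcY (h' ▸ hdY)
      simp [h1, h2]
    · intro u hu x hx hux
      simp only [Finset.mem_insert, Finset.mem_singleton] at hu ⊢
      rcases hu with rfl | rfl
      · simp [hsnb x hx hux]
      · rcases hcn x hx hux with h' | h' | h'
        · simp [h']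
        · exact absurd hux (hw x h')
        · simp [h']
  obtain ⟨w, hw, hcw⟩ := hw
  -- If `k` were the only neighbour of `d` in `P`, then `P - k` would be a third fragment when `c`
  -- and `d` are adjacent, and `{t, d}` would violate `small` otherwise.
  have htwo : ∃ k ∈ P, ∃ l ∈ P, k ≠ l ∧ G.Adj d k ∧ G.Adj d l := by
    obtain ⟨k, hk, hkd⟩ := hPQ.left.touch hYc.1
    by_contra! hno
    have hdn : ∀ u ∈ P.erase k, ¬ G.Adj d u := fun u hu hdu =>
      hno k hk u (Finset.mem_of_mem_erase hu) (Finset.ne_of_mem_erase hu).symm hkd.symm hdu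
    have hne : (P.erase k).Nonempty := by
      rw [← Finset.card_pos]
      have := Finset.card_erase_add_one hk
      omega
    by_cases hcd' : G.Adj c d
    · exact third (P.erase k) k (Finset.erase_subset _ _) hne hk (by simp)
        (fun u _ x hx _ => by by_cases h' : x = k <;> simp [h', hx])
        (fun u hu hcu => hdn u hu (hcd hcd' u (Finset.mem_of_mem_erase hu) hcu)) hdn
    · have hkt : k ≠ t := fun h' => htP (h' ▸ hk)
      have hkd' : k ≠ d := fun h' => hdP (h' ▸ hk)
      have hst : s ≠ t := fun h' => hsY (h' ▸ htY)
      have hsd : s ≠ d := fun h' => hsY (h' ▸ hdY)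
      have hct' : c ≠ t := fun h' => hcY (h' ▸ htY)
      have hcd'' : c ≠ d := fun h' => hcY (h' ▸ hdY)
      refine small {t, d} k ⟨?_, by simp, hYA (hPY hk), by simp [*], ?_⟩
        (by rw [Finset.card_pair htd]; omega) s hsA c hcA (by simp [*]) (by simp [*])
        (fun h' => hsY (h' ▸ hPY hk)) (fun h' => hcY (h' ▸ hPY hk)) hcs
      · exact Finset.insert_subset (hYA htY) (by simpa using hYA hdY)
      · intro u hu x hx hux
        simp only [Finset.mem_insert, Finset.mem_singleton] at hu ⊢
        rcases hu with rfl | rfl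
        · have := hQA.closed u (by simp) x hx hux
          simp at this
          tauto
        · rcases h.cover x hx with h' | h' | rfl
          · rw [Finset.mem_singleton] at h'
            subst h'
            exact absurd (hsnb u (hYA hdY) hux.symm) hcd''.symm
          · rcases hPQ.cover x h' with h'' | h'' | h''
            · by_cases hxk : x = k
              · exact Or.inr hxk
              · exact absurd hux (hdn x (by simp [hxk, h'']))
            · rw [Finset.mem_singleton] at h''
              exact Or.inl (Or.inl h'')
            · exact absurd h''.symm hux.ne
          · exact absurd hux.symm hcd'
  refine hF (Tail.hasFactor (H := P) (c := d) (t := t) (a := c) (s := s) hG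
    ⟨hP2, hdP, htP, hdt.symm, ?_, htwo⟩ ih hP3 (fun h' => hsY (hPY h')) (fun h' => hcY (hPY h'))
    hsc (fun h' => hsY (h' ▸ hdY)) (fun h' => hsY (h' ▸ htY)) (fun h' => hcY (h' ▸ hdY))
    (fun h' => hcY (h' ▸ htY)) ?_ hw hcw)
  · intro v hv htv
    rcases hPQ.right.closed t (by simp) v (hPY hv) htv with h' | h'
    · rw [Finset.mem_singleton] at h'
      exact htP (h' ▸ hv)
    · exact hdP (h' ▸ hv)
  · intro v
    constructor
    · intro hv
      rcases h.cover v hv with h' | h' | h'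
      · rw [Finset.mem_singleton] at h'; simp [h']
      · rcases hPQ.cover v h' with h'' | h'' | h''
        · simp [h'']
        · rw [Finset.mem_singleton] at h''; simp [h'']
        · simp [h'']
      · simp [h']
    · rintro (h' | rfl | rfl | rfl | rfl)
      exacts [hYA (hPY h'), hsA, hcA, hYA hdY, hYA htY]

/-- If `Y` has no cut vertex, take the leaf, `c` and a neighbour in `Y` as a path. Otherwise the
clique of neighbours of `c` in `Y` misses one side of a cut of `Y`. -/
lemma Split.factor_of_leaf {A X Y : Finset V} {c : V} (hG : NoClaw G) (hA : Chain G A)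
    (ih : FactorBelow G A.card) (h : Split G A X Y c) (h3 : A.card % 3 = 0) (hX : X.card = 1) :
    HasFactor G A := by
  have hYc := h.symm.chain_left hG hA
  by_cases hY2 : Conn2 G Y
  · obtain ⟨s, rfl⟩ := Finset.card_eq_one.1 hX
    obtain ⟨w, hw, hwc⟩ := h.right.touch hA.1
    obtain ⟨s', hs, hsc⟩ := h.left.touch hA.1
    rw [Finset.mem_singleton] at hs
    subst hs
    have hcard := h.card
    have hsY : s' ∉ Y := h.disj s' (by simp)
    have hcY := h.right.nmem
    have := Finset.card_erase_add_one hw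
    refine (ih (Y.erase w) (by omega) (hY2.erase_chain hG hw) (by omega)).add hsc hwc.symm
      (fun h' => hsY (h' ▸ hw)) (by simp [hsY]) (by simp [hcY]) (by simp) fun v => ?_
    have h1 := h.cover v
    have h2 := @h.left.sub v
    have h3 := @h.right.sub v
    have h4 := h.left.mem
    grind
  · obtain ⟨P, Q, d, hPQ⟩ := hYc.1.exists_split hY2
    by_cases hQ : ∀ u ∈ Q, ¬ G.Adj c u
    · exact h.factor_of_leaf_of_not_touch hG hA ih h3 hX hPQ hQ
    · refine h.factor_of_leaf_of_not_touch hG hA ih h3 hX hPQ.symm fun p hp hcp => ?_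
      push Not at hQ
      obtain ⟨q, hq, hcq⟩ := hQ
      have hne : p ≠ q := fun h' => hPQ.disj p hp (h' ▸ hq)
      have hadj := h.symm.clique hG hA.1 p (hPQ.left.sub hp) q (hPQ.right.sub hq) hcp hcq hne
      rcases hPQ.left.closed p hp q (hPQ.right.sub hq) hadj with h' | h'
      · exact hPQ.disj q h' hq
      · exact hPQ.right.nmem (h' ▸ hq)

/-! ### The factor theorem for chains -/

lemma Conn.exists_adj {A : Finset V} {x y : V} (hA : Conn G A) (hx : x ∈ A) (hy : y ∈ A)
    (hxy : x ≠ y) : ∃ z ∈ A, G.Adj x z := by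
  by_contra! hc
  have := hA {x} (by simpa using hx) (by simp) (fun u hu v hv huv => by
    rw [Finset.mem_singleton] at hu
    subst hu
    exact absurd huv (hc v hv)) y hy
  exact hxy (Finset.mem_singleton.1 this).symm

lemma Conn2.exists_adj {A : Finset V} {x y o : V} (hA : Conn2 G A) (hx : x ∈ A) (ho : o ∈ A)
    (hxy : x ≠ y) (hox : o ≠ x) (hoy : o ≠ y) : ∃ z ∈ A, z ≠ y ∧ G.Adj x z := by
  by_contra! hc
  have := hA.2 {x} (by simpa using hx) (by simp) y (by simpa using hxy.symm) (fun u hu v hv huv => by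
    rw [Finset.mem_singleton] at hu
    subst hu
    by_cases hvy : v = y
    · exact Or.inr hvy
    · exact absurd huv (hc v hv hvy)) o ho
  rw [Finset.mem_singleton] at this
  tauto

/-- In a 3-connected claw-free set, every edge `xy` extends to a path `xyw` whose deletion leaves
a chain. -/
lemma Conn3.exists_path {A : Finset V} {x y o : V} (hG : NoClaw G) (hA : Conn3 G A) (hx : x ∈ A)
    (hy : y ∈ A) (hxy : G.Adj x y) (ho : o ∈ A) (hox : o ≠ x) (hoy : o ≠ y) :
    ∃ w ∈ (A.erase x).erase y, G.Adj y w ∧ Chain G (((A.erase x).erase y).erase w) := by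
  rcases hA.exists_chain hG hx hy hxy with h | ⟨w, hw, -, hyw, h⟩
  · obtain ⟨w, hw, hwx, hyw⟩ := hA.1.exists_adj hy ho hxy.ne.symm hoy hox
    have : w ∈ (A.erase x).erase y := by simp [hw, hwx, hyw.ne.symm]
    exact ⟨w, this, hyw, h w this⟩
  · exact ⟨w, hw, hyw, h⟩

lemma Conn3.hasFactor {A : Finset V} (hG : NoClaw G) (hA : Conn3 G A)
    (ih : FactorBelow G A.card) (h3 : A.card % 3 = 0) : HasFactor G A := by
  rcases Finset.eq_empty_or_nonempty A with rfl | ⟨x, hx⟩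
  · exact .empty
  have hpos := Finset.card_pos.2 ⟨x, hx⟩
  obtain ⟨y', hy', hxy'⟩ := Finset.exists_mem_ne (s := A) (by omega) x
  obtain ⟨y, hy, hxy⟩ := hA.1.1.exists_adj hx hy' hxy'.symm
  have hyx : y ∈ A.erase x := by simp [hy, hxy.ne.symm]
  have c1 := Finset.card_erase_add_one hx
  have c2 := Finset.card_erase_add_one hyx
  obtain ⟨o, ho⟩ : ((A.erase x).erase y).Nonempty := Finset.card_pos.1 (by omega)
  simp only [Finset.mem_erase] at ho
  obtain ⟨w, hw, hyw, hch⟩ := hA.exists_path hG hx hy hxy ho.2.2 ho.2.1 ho.1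
  have c3 := Finset.card_erase_add_one hw
  have hwx : w ≠ x ∧ w ≠ y ∧ w ∈ A := by grind
  exact (ih _ (by omega) hch (by omega)).add hxy hyw hwx.1.symm (by simp) (by simp) (by simp)
    (fun v => by grind)

/-- A claw-free chain with number of vertices divisible by three has a factor. -/
theorem Chain.hasFactor {A : Finset V} (hG : NoClaw G) (hA : Chain G A) (h3 : A.card % 3 = 0) :
    HasFactor G A := by
  induction hn : A.card using Nat.strong_induction_on generalizing A with
  | _ n ih =>
    subst hn
    have ih' : FactorBelow G A.card := fun B hB hBc hB3 => ih _ hB hBc hB3 rfl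
    by_cases h2 : Conn2 G A
    · by_cases hc3 : Conn3 G A
      · exact hc3.hasFactor hG ih' h3
      · obtain ⟨X, p, q, hX⟩ := h2.exists_leg hc3
        exact hX.factor hG h2 ih' h3
    · obtain ⟨X, Y, c, hs⟩ := hA.1.exists_split h2
      rcases hs.factor hG hA ih' h3 with h | h | h
      · exact h
      · exact hs.factor_of_leaf hG hA ih' h3 h
      · exact hs.symm.factor_of_leaf hG hA ih' h3 h

/-! ### From the graph hypotheses to the working predicates -/

lemma ClawFree.noClaw (h : ClawFree G) : NoClaw G := by
  intro v a b c hva hvb hvc hab hac hbc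
  by_contra! hc
  obtain ⟨h1, h2, h3⟩ := hc
  have h1' := fun e : G.Adj b a => h1 e.symm
  have h2' := fun e : G.Adj c a => h2 e.symm
  have h3' := fun e : G.Adj c b => h3 e.symm
  have hinj : Function.Injective (Sum.elim (fun _ : Fin 1 => v) ![a, b, c]) := by
    have := hva.ne
    have := hvb.ne
    have := hvc.ne
    rintro (i | i) (j | j) hij <;> fin_cases i <;> fin_cases j <;> simp_all
  refine h ⟨⟨⟨Sum.elim (fun _ => v) ![a, b, c], hinj⟩, ?_⟩⟩
  rintro (i | i) (j | j)
  · simp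
  · fin_cases j <;> simp [hva, hvb, hvc]
  · fin_cases i <;> simp [hva.symm, hvb.symm, hvc.symm]
  · fin_cases i <;> fin_cases j <;> simp_all

/-- A walk that starts in `X` and avoids `T` never leaves `X`. -/
lemma IsKConnected.subset_of_closed [Fintype V] {k : ℕ} (h : IsKConnected k G)
    {X T : Finset V} (hT : T.card < k) (hne : X.Nonempty) (hXT : ∀ u ∈ X, u ∉ T)
    (hcl : ∀ u ∈ X, ∀ v, G.Adj u v → v ∈ X ∨ v ∈ T) : ∀ v, v ∈ X ∨ v ∈ T := by
  intro v
  by_contra! hv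
  obtain ⟨u, hu⟩ := hne
  obtain ⟨p⟩ := (h.2 T hT).preconnected ⟨u, by simpa using hXT u hu⟩ ⟨v, by simpa using hv.2⟩
  have : ∀ (a b : ((T : Set V)ᶜ : Set V)), (G.induce (T : Set V)ᶜ).Walk a b → a.1 ∈ X →
      b.1 ∈ X := by
    intro a b p
    induction p with
    | nil => exact id
    | @cons a b c hab p ih =>
      intro ha
      refine ih ((hcl a ha b hab).resolve_right ?_)
      exact fun h' => b.2 h'
  exact hv.1 (this _ _ p hu)

lemma IsKConnected.conn3 [Fintype V] (h : IsKConnected 3 G) : Conn3 G Finset.univ := by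
  refine ⟨⟨fun X _ hne hcl v _ => ?_, fun X _ hne p hp hcl v _ => ?_⟩,
    fun X _ hne p hp q hq hcl v _ => ?_⟩
  · have := h.subset_of_closed (T := ∅) (by simp) hne (by simp)
      (fun u hu v huv => Or.inl (hcl u hu v (by simp) huv)) v
    simpa using this
  · have := h.subset_of_closed (T := {p}) (by simp) hne (fun u hu h' => by simp_all)
      (fun u hu v huv => by simpa using hcl u hu v (by simp) huv) v
    simpa using this
  · have := h.subset_of_closed (T := {p, q})
      (Finset.card_le_two.trans_lt (by norm_num)) hne (fun u hu h' => by
        simp only [Finset.mem_insert, Finset.mem_singleton] at h'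
        rcases h' with rfl | rfl
        exacts [hp hu, hq hu])
      (fun u hu v huv => by simpa using hcl u hu v (by simp) huv) v
    simpa using this

/-! ### From path partitions to Λ-factors -/

/-- `v` is one of the entries of the triple `τ`. -/
def MemTriple (v : V) (τ : V × V × V) : Prop := v = τ.1 ∨ v = τ.2.1 ∨ v = τ.2.2

/-- `T` partitions `S` into three-vertex paths of `G`. -/
structure IsPartition (G : SimpleGraph V) (S : Finset V) (T : Set (V × V × V)) : Prop where
  path : ∀ τ ∈ T, G.Adj τ.1 τ.2.1 ∧ G.Adj τ.2.1 τ.2.2 ∧ τ.1 ≠ τ.2.2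
  sub : ∀ τ ∈ T, ∀ v, MemTriple v τ → v ∈ S
  cover : ∀ v ∈ S, ∃ τ ∈ T, MemTriple v τ
  unique : ∀ τ ∈ T, ∀ σ ∈ T, ∀ v, MemTriple v τ → MemTriple v σ → τ = σ

lemma IsPartition.insert {S A : Finset V} {T : Set (V × V × V)} {a b c : V}
    (h : IsPartition G S T) (ha : a ∉ S) (hb : b ∉ S) (hc : c ∉ S) (hab : G.Adj a b)
    (hbc : G.Adj b c) (hac : a ≠ c) (hA : ∀ v, v ∈ A ↔ v = a ∨ v = b ∨ v = c ∨ v ∈ S) :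
    IsPartition G A (insert (a, b, c) T) := by
  have hS : ∀ σ ∈ T, ∀ v, MemTriple v (a, b, c) → MemTriple v σ → False := by
    intro σ hσ v hv hv'
    have := h.sub σ hσ v hv'
    rcases hv with rfl | rfl | rfl <;> contradiction
  refine ⟨?_, ?_, ?_, ?_⟩
  · rintro τ (rfl | hτ)
    exacts [⟨hab, hbc, hac⟩, h.path τ hτ]
  · rintro τ (rfl | hτ) v hv
    · rw [hA]
      simp only [MemTriple] at hv
      tauto
    · rw [hA]
      have := h.sub τ hτ v hv
      tauto
  · intro v hv
    rw [hA] at hv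
    by_cases hvS : v ∈ S
    · obtain ⟨τ, hτ, hvτ⟩ := h.cover v hvS
      exact ⟨τ, Or.inr hτ, hvτ⟩
    · refine ⟨(a, b, c), Or.inl rfl, ?_⟩
      simp only [MemTriple]
      tauto
  · rintro τ (rfl | hτ) σ (rfl | hσ) v hv hv'
    · rfl
    · exact (hS σ hσ v hv hv').elim
    · exact (hS τ hτ v hv' hv).elim
    · exact h.unique τ hτ σ hσ v hv hv'

lemma HasFactor.exists_isPartition {S : Finset V} (h : HasFactor G S) :
    ∃ T, IsPartition G S T := by
  induction h with
  | empty => exact ⟨∅, by simp, by simp, by simp, by simp⟩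
  | cons ha hb hc hab hbc hac _ ih =>
    obtain ⟨T, hT⟩ := ih
    exact ⟨_, hT.insert ha hb hc hab hbc hac (by simp)⟩

/-- The subgraph formed by the paths of a partition. -/
def IsPartition.subgraph [Fintype V] {T : Set (V × V × V)} (h : IsPartition G Finset.univ T) :
    G.Subgraph where
  verts := Set.univ
  Adj u v := ∃ τ ∈ T, (u = τ.1 ∧ v = τ.2.1) ∨ (u = τ.2.1 ∧ v = τ.1) ∨ (u = τ.2.1 ∧ v = τ.2.2) ∨
    (u = τ.2.2 ∧ v = τ.2.1)
  adj_sub := by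
    rintro u v ⟨τ, hτ, h'⟩
    obtain ⟨h1, h2, -⟩ := h.path τ hτ
    rcases h' with ⟨rfl, rfl⟩ | ⟨rfl, rfl⟩ | ⟨rfl, rfl⟩ | ⟨rfl, rfl⟩
    exacts [h1, h1.symm, h2, h2.symm]
  edge_vert := fun _ => Set.mem_univ _
  symm := ⟨by
    rintro u v ⟨τ, hτ, h'⟩
    exact ⟨τ, hτ, by tauto⟩⟩

lemma IsPartition.adj_iff [Fintype V] {T : Set (V × V × V)} (h : IsPartition G Finset.univ T)
    {a b c u v : V} (hT : (a, b, c) ∈ T) (hu : MemTriple u (a, b, c)) :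
    h.subgraph.Adj u v ↔
      (u = a ∧ v = b) ∨ (u = b ∧ v = a) ∨ (u = b ∧ v = c) ∨ (u = c ∧ v = b) := by
  constructor
  · rintro ⟨τ, hτ, h'⟩
    have : τ = (a, b, c) := h.unique τ hτ _ hT u (by simp only [MemTriple]; tauto) hu
    subst this
    exact h'
  · exact fun h' => ⟨_, hT, h'⟩

lemma IsPartition.isFactor [Fintype V] {T : Set (V × V × V)} (h : IsPartition G Finset.univ T) :
    IsFactor Lam h.subgraph := by
  refine ⟨fun C => ?_, fun v => Set.mem_univ v⟩
  obtain ⟨⟨v, hv⟩, rfl⟩ := C.exists_rep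
  obtain ⟨⟨a, b, c⟩, hT, hvT⟩ := h.cover v (by simp)
  obtain ⟨hab, hbc, hac⟩ := h.path _ hT
  simp only at hab hbc hac
  have adj := fun {u v} => h.adj_iff (u := u) (v := v) hT
  -- The component is exactly the triple: adjacency does not leave it, and every entry reaches the
  -- middle vertex `b`.
  have hsupp : ∀ u : h.subgraph.verts, u ∈ (h.subgraph.coe.connectedComponentMk ⟨v, hv⟩).supp ↔
      MemTriple u.1 (a, b, c) := by
    intro u
    rw [SimpleGraph.ConnectedComponent.mem_supp_iff, SimpleGraph.ConnectedComponent.eq]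
    constructor
    · rintro ⟨p⟩
      have : ∀ (x y : h.subgraph.verts), h.subgraph.coe.Walk x y → MemTriple x.1 (a, b, c) →
          MemTriple y.1 (a, b, c) := by
        intro x y p
        induction p with
        | nil => exact id
        | cons hxy p ih =>
          intro hx
          refine ih ?_
          have := (adj hx).1 hxy
          simp only [MemTriple]
          tauto
      exact this _ _ p.reverse hvT
    · have hb : ∀ x : h.subgraph.verts, MemTriple x.1 (a, b, c) →
          h.subgraph.coe.Reachable x ⟨b, Set.mem_univ b⟩ := by
        rintro ⟨x, hx⟩ (rfl | rfl | rfl)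
        · exact SimpleGraph.Adj.reachable ((adj (Or.inl rfl)).2 (by simp))
        · exact SimpleGraph.Reachable.refl _
        · exact SimpleGraph.Adj.reachable ((adj (Or.inr (Or.inr rfl))).2 (by simp))
      intro hu
      exact (hb u hu).trans (hb ⟨v, hv⟩ hvT).symm
  have hmem : ∀ i : Fin 3, MemTriple (![a, b, c] i) (a, b, c) := by
    intro i
    fin_cases i <;> simp [MemTriple]
  let f : Fin 3 → (h.subgraph.coe.connectedComponentMk ⟨v, hv⟩).supp := fun i =>
    ⟨⟨![a, b, c] i, Set.mem_univ _⟩, (hsupp _).2 (hmem i)⟩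
  have hinj : Function.Injective ![a, b, c] := by
    have := hab.ne
    have := hbc.ne
    intro i j hij
    fin_cases i <;> fin_cases j <;> simp_all
  have hf : Function.Bijective f := by
    refine ⟨fun i j hij => hinj (congrArg (fun x => x.1.1) hij), ?_⟩
    rintro ⟨⟨u, hu'⟩, hu⟩
    rcases (hsupp _).1 hu with rfl | rfl | rfl
    exacts [⟨0, rfl⟩, ⟨1, rfl⟩, ⟨2, rfl⟩]
  refine ⟨RelIso.symm ⟨Equiv.ofBijective f hf, ?_⟩⟩
  intro i j
  change h.subgraph.Adj (![a, b, c] i) (![a, b, c] j) ↔ _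
  rw [adj (hmem i), SimpleGraph.pathGraph_adj]
  have h1 := hab.ne
  have h2 := hbc.ne
  fin_cases i <;> fin_cases j <;> simp [h1, h2, hac, h1.symm, h2.symm, hac.symm]

/-- In a 3-connected claw-free graph of order divisible by three, for every edge `xz` there is a
factor in which `x` is an end vertex of its path and `z` is its only neighbour. -/
lemma exists_isFactor [Fintype V] (hconn : IsKConnected 3 G) (hclaw : ClawFree G)
    (hcard : Fintype.card V % 3 = 0) {x z : V} (hxz : G.Adj x z) :
    ∃ P : G.Subgraph, IsFactor Lam P ∧ ∀ v, P.Adj x v ↔ v = z := by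
  have hG := hclaw.noClaw
  have hA := hconn.conn3
  have hz : z ∈ Finset.univ.erase x := by simp [hxz.ne.symm]
  have c1 := Finset.card_erase_add_one (Finset.mem_univ x)
  have c2 := Finset.card_erase_add_one hz
  have c0 : 3 < Fintype.card V := by simpa using hconn.1
  rw [Finset.card_univ] at c1
  obtain ⟨o, ho⟩ : ((Finset.univ.erase x).erase z).Nonempty := Finset.card_pos.1 (by omega)
  simp only [Finset.mem_erase] at ho
  obtain ⟨w, hw, hzw, hch⟩ := hA.exists_path hG (Finset.mem_univ x) (Finset.mem_univ z) hxz
    (Finset.mem_univ o) ho.2.1 ho.1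
  have c3 := Finset.card_erase_add_one hw
  obtain ⟨T, hT⟩ := (hch.hasFactor hG (by omega)).exists_isPartition
  have hxw : x ≠ w := by rintro rfl; simp at hw
  -- Listing `x` first makes it an end vertex, so `z` is its only neighbour in the factor.
  have hT' := hT.insert (A := Finset.univ) (a := x) (b := z) (c := w) (by simp) (by simp) (by simp)
    hxz hzw hxw (fun v => by simp; tauto)
  refine ⟨_, hT'.isFactor, fun v => ?_⟩
  rw [hT'.adj_iff (Set.mem_insert _ _) (Or.inl rfl)]
  simp [hxz.ne, hxw]

end LambdaFactor

theorem mainTheorem1 {V : Type*} [Fintype V] (G : SimpleGraph V)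
    (hconn : LambdaFactor.IsKConnected 3 G) (hclaw : LambdaFactor.ClawFree G)
    (hcard : Fintype.card V % 3 = 0) (e : Sym2 V) (he : e ∈ G.edgeSet) :
    (∃ P : G.Subgraph, LambdaFactor.IsFactor LambdaFactor.Lam P ∧ e ∈ P.edgeSet) ∧
    (∃ P : G.Subgraph, LambdaFactor.IsFactor LambdaFactor.Lam P ∧ e ∉ P.edgeSet) := by
  classical
  induction e with
  | _ x y =>
    rw [SimpleGraph.mem_edgeSet] at he
    constructor
    · obtain ⟨P, hP, hadj⟩ := LambdaFactor.exists_isFactor hconn hclaw hcard he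
      exact ⟨P, hP, by rw [SimpleGraph.Subgraph.mem_edgeSet, hadj]⟩
    · obtain ⟨o, ho⟩ : (Finset.univ \ {x, y} : Finset V).Nonempty := by
        rw [← Finset.card_pos]
        have h1 := Finset.le_card_sdiff {x, y} (Finset.univ : Finset V)
        have h2 := Finset.card_le_two (a := x) (b := y)
        have h3 : 3 < Fintype.card V := by simpa using hconn.1
        rw [Finset.card_univ] at h1
        omega
      simp only [Finset.mem_sdiff, Finset.mem_insert, Finset.mem_singleton, not_or] at ho
      -- A factor using the other edge `xz`, with `x` as an end vertex, cannot use `xy`.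
      obtain ⟨z, -, hzy, hxz⟩ := hconn.conn3.1.exists_adj (Finset.mem_univ x) (Finset.mem_univ o)
        he.ne ho.2.1 ho.2.2
      obtain ⟨P, hP, hadj⟩ := LambdaFactor.exists_isFactor hconn hclaw hcard hxz
      refine ⟨P, hP, ?_⟩
      rw [SimpleGraph.Subgraph.mem_edgeSet, hadj]
      exact hzy.symm
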